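/- Let $X$ be a Tikhonov space (completely regular and Hausdorff). Let $L(X)$ be the free locally convex space on $X$, in either its real or its complex version: the set $X$ is an algebraic basis of $L(X)$, and $L(X)$ carries the finest locally convex vector topology for which the inclusion $X\to L(X)$ is continuous; equivalently, for every continuous map $f$ from $X$ to a Hausdorff locally convex space $E$, the linear extension $\bar f:L(X)\to E$ is continuous. Let $A(X)$ be the free abelian topological group on $X$: the free abelian group with set of generators $X$, with the finest group topology for which the inclusion $X\to A(X)$ is continuous; equivalently, every continuous map from $X$ to a Hausdorff abelian topological group $G$ extends to a continuous homomorphism $A(X)\to G$. For a complex Hilbert space $H$ (not necessarily separable) let $U_s(H)$ be the unitary group of $H$ with the strong operator topology, that is, the topology inherited from the product $H^H$. Then each of the following topological groups admits a topologically faithful unitary representation, i.e. there are a complex Hilbert space $H$ and a homomorphism from the group to $U_s(H)$ which is a homeomorphic embedding: the additive group of the real space $L(X)$, the additive group of the complex space $L(X)$, and the group $A(X)$. -/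

import Mathlib

open Topology

universe u v

noncomputable section

/-! ### Free locally convex spaces -/

/-- On a Tikhonov space continuous functions separate a point from a finite set. -/
theorem exists_continuous_separating {X : Type u} [TopologicalSpace X] [T35Space X]
    (s : Finset X) (x : X) :
    ∃ f : X → ℝ, Continuous f ∧ f x = 1 ∧ ∀ y ∈ s, y ≠ x → f y = 0 := by
  classical
  obtain ⟨f, hf, h0, h1⟩ := CompletelyRegularSpace.completely_regular x (s.erase x : Finset X)
    (s.erase x).finite_toSet.isClosed (by simp)
  refine ⟨fun y => 1 - (f y : ℝ), by fun_prop, by simp [h0], fun y hy hne => ?_⟩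
  have : f y = 1 := h1 (by simp [hy, hne])
  simp [this]

/-- The vector space over `𝕜` (`ℝ` or `ℂ`) with algebraic basis `X`. It carries the topology
of the free locally convex space `L(X)`, see the instances below. -/
def FreeLCS (𝕜 : Type v) [RCLike 𝕜] (X : Type u) : Type (max u v) := X →₀ 𝕜

namespace FreeLCS

instance instAddCommGroup (𝕜 : Type v) [RCLike 𝕜] (X : Type u) : AddCommGroup (FreeLCS 𝕜 X) :=
  inferInstanceAs (AddCommGroup (X →₀ 𝕜))

instance instModule (𝕜 : Type v) [RCLike 𝕜] (X : Type u) (R : Type*) [Semiring R] [Module R 𝕜] :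
    Module R (FreeLCS 𝕜 X) :=
  inferInstanceAs (Module R (X →₀ 𝕜))

instance instIsScalarTower (𝕜 : Type v) [RCLike 𝕜] (X : Type u) :
    IsScalarTower ℝ 𝕜 (FreeLCS 𝕜 X) :=
  inferInstanceAs (IsScalarTower ℝ 𝕜 (X →₀ 𝕜))

/-- The algebraic basis formed by the points of `X`. -/
def basis (𝕜 : Type v) [RCLike 𝕜] (X : Type u) : Module.Basis X 𝕜 (FreeLCS 𝕜 X) :=
  Finsupp.basisSingleOne

/-- A topology on the vector space is admissible if it is a locally convex vector topology for
which the inclusion of the space `X` is continuous. -/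
def IsAdmissible (𝕜 : Type v) [RCLike 𝕜] (X : Type u) [TopologicalSpace X]
    (t : TopologicalSpace (FreeLCS 𝕜 X)) : Prop :=
  @IsTopologicalAddGroup (FreeLCS 𝕜 X) t _ ∧
    @ContinuousSMul 𝕜 (FreeLCS 𝕜 X) _ _ t ∧
    @LocallyConvexSpace ℝ (FreeLCS 𝕜 X) _ _ _ _ t ∧
    Continuous[_, t] (basis 𝕜 X)

/-- The topology of `L(X)`: the finest admissible topology. (In Mathlib's order on topologies
finer means smaller; `isAdmissible` below shows that the infimum is itself admissible.) -/
instance instTopologicalSpace (𝕜 : Type v) [RCLike 𝕜] (X : Type u) [TopologicalSpace X] :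
    TopologicalSpace (FreeLCS 𝕜 X) :=
  sInf {t | IsAdmissible 𝕜 X t}

theorem isAdmissible (𝕜 : Type v) [RCLike 𝕜] (X : Type u) [TopologicalSpace X] :
    IsAdmissible 𝕜 X (instTopologicalSpace 𝕜 X) :=
  ⟨topologicalAddGroup_sInf fun _ h => h.1, continuousSMul_sInf fun _ h => h.2.1,
    LocallyConvexSpace.sInf fun _ h => h.2.2.1, continuous_sInf_rng.2 fun _ h => h.2.2.2⟩

instance instIsTopologicalAddGroup (𝕜 : Type v) [RCLike 𝕜] (X : Type u) [TopologicalSpace X] :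
    IsTopologicalAddGroup (FreeLCS 𝕜 X) := (isAdmissible 𝕜 X).1

instance instContinuousSMul (𝕜 : Type v) [RCLike 𝕜] (X : Type u) [TopologicalSpace X] :
    ContinuousSMul 𝕜 (FreeLCS 𝕜 X) := (isAdmissible 𝕜 X).2.1

instance instLocallyConvexSpace (𝕜 : Type v) [RCLike 𝕜] (X : Type u) [TopologicalSpace X] :
    LocallyConvexSpace ℝ (FreeLCS 𝕜 X) := (isAdmissible 𝕜 X).2.2.1

theorem continuous_basis (𝕜 : Type v) [RCLike 𝕜] (X : Type u) [TopologicalSpace X] :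
    Continuous (basis 𝕜 X) := (isAdmissible 𝕜 X).2.2.2

/-- The universal property: the linear extension of a continuous map from `X` to a locally
convex space is continuous. -/
theorem continuous_constr {𝕜 : Type v} [RCLike 𝕜] {X : Type u} [TopologicalSpace X]
    {E : Type*} [AddCommGroup E] [Module 𝕜 E] [Module ℝ E] [IsScalarTower ℝ 𝕜 E]
    [t : TopologicalSpace E] [IsTopologicalAddGroup E] [ContinuousSMul 𝕜 E]
    [LocallyConvexSpace ℝ E] {f : X → E} (hf : Continuous f) :
    Continuous ((basis 𝕜 X).constr 𝕜 f) := by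
  refine continuous_iff_le_induced.2 (sInf_le ⟨?_, ?_, ?_, ?_⟩)
  · exact topologicalAddGroup_induced ((basis 𝕜 X).constr 𝕜 f)
  · exact continuousSMul_induced ((basis 𝕜 X).constr 𝕜 f)
  · exact LocallyConvexSpace.induced (((basis 𝕜 X).constr 𝕜 f).restrictScalars ℝ)
  · refine continuous_induced_rng.2 ?_
    convert hf using 1
    funext x
    simp

/-- For a Tikhonov space `X` the topology is Hausdorff. -/
instance instT2Space (𝕜 : Type v) [RCLike 𝕜] (X : Type u) [TopologicalSpace X] [T35Space X] :
    T2Space (FreeLCS 𝕜 X) := by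
  rw [IsTopologicalAddGroup.t2Space_iff_zero_closed, ← isOpen_compl_iff]
  refine isOpen_iff_mem_nhds.2 fun v hv => ?_
  have hr : (basis 𝕜 X).repr v ≠ 0 := by simpa using hv
  obtain ⟨x, hx⟩ := Finsupp.ne_iff.1 hr
  obtain ⟨f, hf, h1, h0⟩ := exists_continuous_separating ((basis 𝕜 X).repr v).support x
  have hc : Continuous ((basis 𝕜 X).constr 𝕜 fun y => ((f y : ℝ) : 𝕜)) :=
    continuous_constr (RCLike.continuous_ofReal.comp hf)
  have hne : (basis 𝕜 X).constr 𝕜 (fun y => ((f y : ℝ) : 𝕜)) v ≠ 0 := by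
    rw [Module.Basis.constr_apply, Finsupp.sum, Finset.sum_eq_single x]
    · simpa [h1] using hx
    · intro y hy hyx
      simp [h0 y hy hyx]
    · intro h
      simp [Finsupp.notMem_support_iff.1 h]
  filter_upwards [hc.continuousAt.eventually_ne hne] with w hw
  rintro rfl
  simp at hw

/-- For a Tikhonov space `X` the inclusion of `X` is a topological embedding. -/
theorem isEmbedding_basis (𝕜 : Type v) [RCLike 𝕜] (X : Type u) [TopologicalSpace X]
    [T35Space X] : IsEmbedding (basis 𝕜 X) := by
  refine ⟨isInducing_iff_nhds.2 fun x => le_antisymm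
    (continuous_basis 𝕜 X).continuousAt.le_comap fun s hs => ?_, (basis 𝕜 X).injective⟩
  obtain ⟨U, hU, hUo, hxU⟩ := mem_nhds_iff.1 hs
  obtain ⟨f, hf, h0, h1⟩ := CompletelyRegularSpace.completely_regular x Uᶜ
    hUo.isClosed_compl (by simpa using hxU)
  have hc : Continuous ((basis 𝕜 X).constr 𝕜 fun y => (((f y : ℝ)) : 𝕜)) :=
    continuous_constr (RCLike.continuous_ofReal.comp (continuous_subtype_val.comp hf))
  refine Filter.mem_comap.2
    ⟨_, hc.continuousAt.eventually_ne (y := 1) (by simp [h0]), fun y hy => hU ?_⟩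
  by_contra hyU
  have : f y = 1 := h1 hyU
  simp [this] at hy

end FreeLCS

/-! ### Free abelian topological groups -/

/-- The free abelian group on `X`. It carries the topology of the free abelian topological
group `A(X)`, see the instances below. -/
def FreeAbTopGroup (X : Type u) : Type u := FreeAbelianGroup X

namespace FreeAbTopGroup

instance instAddCommGroup (X : Type u) : AddCommGroup (FreeAbTopGroup X) :=
  inferInstanceAs (AddCommGroup (FreeAbelianGroup X))

/-- The inclusion of the free generators. -/
def of (X : Type u) : X → FreeAbTopGroup X := FreeAbelianGroup.of

/-- The additive extension of a map from `X` to an abelian group. -/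
def lift {X : Type u} {G : Type*} [AddCommGroup G] (f : X → G) : FreeAbTopGroup X →+ G :=
  FreeAbelianGroup.lift f

theorem lift_of {X : Type u} {G : Type*} [AddCommGroup G] (f : X → G) (x : X) :
    lift f (of X x) = f x := FreeAbelianGroup.lift_apply_of f x

/-- A topology on the free abelian group is admissible if it is a group topology for which the
inclusion of the space `X` is continuous. -/
def IsAdmissible (X : Type u) [TopologicalSpace X]
    (t : TopologicalSpace (FreeAbTopGroup X)) : Prop :=
  @IsTopologicalAddGroup (FreeAbTopGroup X) t _ ∧ Continuous[_, t] (of X)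

/-- The topology of `A(X)`: the finest admissible topology. -/
instance instTopologicalSpace (X : Type u) [TopologicalSpace X] :
    TopologicalSpace (FreeAbTopGroup X) :=
  sInf {t | IsAdmissible X t}

theorem isAdmissible (X : Type u) [TopologicalSpace X] :
    IsAdmissible X (instTopologicalSpace X) :=
  ⟨topologicalAddGroup_sInf fun _ h => h.1, continuous_sInf_rng.2 fun _ h => h.2⟩

instance instIsTopologicalAddGroup (X : Type u) [TopologicalSpace X] :
    IsTopologicalAddGroup (FreeAbTopGroup X) := (isAdmissible X).1

theorem continuous_of (X : Type u) [TopologicalSpace X] : Continuous (of X) := (isAdmissible X).2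

/-- The universal property: the additive extension of a continuous map from `X` to an abelian
topological group is continuous. -/
theorem continuous_lift {X : Type u} [TopologicalSpace X] {G : Type*} [AddCommGroup G]
    [TopologicalSpace G] [IsTopologicalAddGroup G] {f : X → G} (hf : Continuous f) :
    Continuous (lift f) := by
  refine continuous_iff_le_induced.2 (sInf_le ⟨topologicalAddGroup_induced (lift f), ?_⟩)
  refine continuous_induced_rng.2 ?_
  convert hf using 1
  funext x
  exact lift_of f x

/-- The canonical homomorphism `A(X) → L(X)` is injective. -/
theorem injective_lift_basis (X : Type u) :
    Function.Injective (lift (FreeLCS.basis ℝ X)) := by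
  have key : (FreeLCS.basis ℝ X).repr.toLinearMap.toAddMonoidHom.comp
      (FreeAbelianGroup.lift (FreeLCS.basis ℝ X)) =
      (Finsupp.mapRange.addMonoidHom (Int.castAddHom ℝ)).comp FreeAbelianGroup.toFinsupp := by
    ext1 x
    simp
  have hinj : Function.Injective ((Finsupp.mapRange.addMonoidHom (Int.castAddHom ℝ)).comp
      (FreeAbelianGroup.toFinsupp (X := X))) :=
    (Finsupp.mapRange_injective (Int.castAddHom ℝ) (map_zero _) Int.cast_injective).comp
      (FreeAbelianGroup.equivFinsupp X).injective
  rw [← key] at hinj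
  exact Function.Injective.of_comp (f := (FreeLCS.basis ℝ X).repr) hinj

/-- For a Tikhonov space `X` the topology is Hausdorff. -/
instance instT2Space (X : Type u) [TopologicalSpace X] [T35Space X] :
    T2Space (FreeAbTopGroup X) :=
  T2Space.of_injective_continuous (injective_lift_basis X)
    (continuous_lift (FreeLCS.continuous_basis ℝ X))

/-- For a Tikhonov space `X` the inclusion of `X` is a topological embedding. -/
theorem isEmbedding_of (X : Type u) [TopologicalSpace X] [T35Space X] : IsEmbedding (of X) := by
  refine IsEmbedding.of_comp (continuous_of X)
    (continuous_lift (FreeLCS.continuous_basis ℝ X)) ?_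
  convert FreeLCS.isEmbedding_basis ℝ X using 1
  funext x
  exact lift_of _ x

end FreeAbTopGroup

/-! ### Unitary representations -/

/-- `U_s(H)`: the unitary group of a complex Hilbert space `H`. It carries the strong operator
topology, not the norm topology, which is why it is a type synonym. -/
def StrongUnitaryGroup (H : Type u) [NormedAddCommGroup H] [InnerProductSpace ℂ H]
    [CompleteSpace H] : Type u :=
  unitary (H →L[ℂ] H)

namespace StrongUnitaryGroup

instance instGroup (H : Type u) [NormedAddCommGroup H] [InnerProductSpace ℂ H]
    [CompleteSpace H] : Group (StrongUnitaryGroup H) :=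
  inferInstanceAs (Group (unitary (H →L[ℂ] H)))

/-- The map `H → H` underlying a unitary operator. -/
def toFun {H : Type u} [NormedAddCommGroup H] [InnerProductSpace ℂ H] [CompleteSpace H]
    (U : StrongUnitaryGroup H) : H → H :=
  (Subtype.val (p := fun T : H →L[ℂ] H => T ∈ unitary (H →L[ℂ] H)) U : H →L[ℂ] H)

/-- The strong operator topology: the topology inherited from the product `H ^ H`. -/
instance instTopologicalSpace (H : Type u) [NormedAddCommGroup H] [InnerProductSpace ℂ H]
    [CompleteSpace H] : TopologicalSpace (StrongUnitaryGroup H) :=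
  TopologicalSpace.induced toFun Pi.topologicalSpace

end StrongUnitaryGroup

/-- A topological group `G` admits a topologically faithful unitary representation: a homomorphism
from `G` to `U_s(H)`, for some complex Hilbert space `H`, which is a homeomorphic embedding. -/
def UnitarilyRepresentable (G : Type u) [Group G] [TopologicalSpace G] : Prop :=
  ∃ (H : Type u) (_ : NormedAddCommGroup H) (_ : InnerProductSpace ℂ H) (_ : CompleteSpace H)
    (ρ : G →* StrongUnitaryGroup H), IsEmbedding ρ

end

/-!
A function `N` of negative type on an abelian group gives positive definite functions `exp (-N)`
(Schoenberg), and the Hilbert space of the translation invariant kernel `exp (-N (x - y))` carries a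
unitary representation. So it suffices to find, for every neighbourhood `U` of `0` in the group, a
continuous `N` of negative type with `{N < ε} ⊆ U` (`unitarilyRepresentable_of_isNegativeType`).

Let `p` be a continuous seminorm that is small only in `U` (a vector space seminorm for `L(X)`, a
group seminorm for `A(X)`). It is bounded by a seminorm of `ℓ¹` type, as follows. Well-order `X`,
and for a radius `r` send each point `x` to the least point `α` with `p (x - α) < r`; this is a
partition of `X` into small pieces. Taking `r = t / 2 ^ n` gives successive approximations of each
`x` in `X`, hence of every finite linear combination `v` of points, and the triangle inequality for
the telescoping sum bounds `p v` by
`∑ n, ∑ (a, b), |v {x | x is approximated by a at stage n and by b at stage n + 1}| * p (a - b)`,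
where `v S` is the sum of the coefficients of `v` over `S`. The terms are absolute values of
additive functions of `v` (`|re| + |im|` for complex scalars), so this sum is of negative type. The coefficients `v S` are integers when
those of `v` are, so that the bound holds for group seminorms as well as for vector space seminorms,
and `A(X)` needs no embedding into `L(X)`.

For fixed `t` the sum is not continuous in the points of `X`, but its mean over `t` in `(0, 1)` is
(`partitionNorm`, `tendsto_partitionNorm_single_sub_single`): for a given point `x` the
approximation is a monotone function of the radius with values in a well-ordered set, so it is
locally constant outside a countable set of radii, and at such radii it is also locally constant in
the point. The mean is a seminorm, continuous on `X`, hence continuous on the free object by its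
universal property; it still dominates `p` (`apply_linearCombination_le_partitionNorm`) and is of
negative type.
-/

/-! ### Positive semidefinite kernels -/

theorem Matrix.PosSemidef.of_tendsto {S α : Type*} {l : Filter α} [l.NeBot]
    {M : α → Matrix S S ℝ} {L : Matrix S S ℝ} (hM : ∀ a, (M a).PosSemidef)
    (h : ∀ i j, Filter.Tendsto (fun a => M a i j) l (𝓝 (L i j))) : L.PosSemidef := by
  refine ⟨Matrix.IsHermitian.ext fun i j => ?_, fun x => ?_⟩
  · refine tendsto_nhds_unique (f := fun a => M a i j) (l := l) ?_ (h i j)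
    simpa using (h j i).congr fun a => by simpa using (hM a).isHermitian.apply i j
  · have hlim : Filter.Tendsto
        (fun a => x.sum fun i xi => x.sum fun j xj => star xi * M a i j * xj) l
        (𝓝 (x.sum fun i xi => x.sum fun j xj => star xi * L i j * xj)) :=
      tendsto_finsetSum _ fun i _ => tendsto_finsetSum _ fun j _ =>
        ((h i j).const_mul _).mul_const _
    exact ge_of_tendsto' hlim fun a => (hM a).2 x

theorem Matrix.posSemidef_of_finite_submatrix {S : Type*} {M : Matrix S S ℝ}
    (h : ∀ s : Finset S, (M.submatrix ((↑) : s → S) ((↑) : s → S)).PosSemidef) :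
    M.PosSemidef := by
  classical
  refine ⟨Matrix.IsHermitian.ext fun i j => ?_, fun x => ?_⟩
  · simpa using (h {i, j}).isHermitian.apply ⟨i, by simp⟩ ⟨j, by simp⟩
  · simpa [Finsupp.sum, ← Finset.sum_attach x.support, ← Finset.subtype_mem_eq_attach,
      ← Finsupp.subtypeDomain_apply, ← Finsupp.support_subtypeDomain] using
      (h x.support).2 (x.subtypeDomain (· ∈ x.support))

theorem Matrix.posSemidef_rankOne {S : Type*} (a : S → ℝ) :
    (Matrix.of fun i j => a i * a j).PosSemidef := by
  refine ⟨Matrix.IsHermitian.ext fun i j => by simp [mul_comm], fun x => ?_⟩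
  have : (x.sum fun i xi => x.sum fun j xj => star xi * Matrix.of (fun i j => a i * a j) i j * xj)
      = (x.sum fun i xi => xi * a i) * (x.sum fun i xi => xi * a i) := by
    simp only [Finsupp.sum, Finset.sum_mul_sum]
    exact Finset.sum_congr rfl fun i _ => Finset.sum_congr rfl fun j _ => by
      simp [Matrix.of_apply]; ring
  rw [this]
  exact mul_self_nonneg _

/-- Entrywise exponentials preserve positive semidefiniteness: the partial sums of the exponential
series are sums of Hadamard powers. -/
theorem Matrix.PosSemidef.exp_entrywise {S : Type*} {M : Matrix S S ℝ} (hM : M.PosSemidef) :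
    (M.map Real.exp).PosSemidef := by
  have hpow : ∀ n : ℕ, (M.map (· ^ n)).PosSemidef := by
    intro n
    induction n with
    | zero => convert Matrix.posSemidef_rankOne (fun _ : S => (1 : ℝ)) using 1; ext; simp
    | succ n ih =>
      rw [show M.map (· ^ (n + 1)) = (M.map (· ^ n)).hadamard M from by ext; simp [pow_succ]]
      exact ih.hadamard hM
  refine Matrix.PosSemidef.of_tendsto (l := Filter.atTop)
    (M := fun n : ℕ => ∑ k ∈ Finset.range n, ((k.factorial : ℝ)⁻¹) • M.map (· ^ k)) (fun n => ?_)
    fun i j => ?_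
  · exact Matrix.posSemidef_sum _ fun k _ => (hpow k).smul (by positivity)
  · have := (NormedSpace.expSeries_div_hasSum_exp (M i j)).tendsto_sum_nat
    rw [← Real.exp_eq_exp_ℝ] at this
    simpa [Matrix.sum_apply, div_eq_inv_mul] using this

theorem Matrix.posSemidef_measure_inter' {α S : Type*} [MeasurableSpace α]
    (μ : MeasureTheory.Measure α) {s : S → Set α} (hs : ∀ j, MeasurableSet (s j))
    (hμ : ∀ j, μ (s j) ≠ ⊤) : (Matrix.of fun i j => μ.real (s i ∩ s j)).PosSemidef :=
  Matrix.posSemidef_of_finite_submatrix fun t =>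
    MeasureTheory.posSemidef_matrix_measure_inter (s := fun i : t => s i)
      (fun _ => hs _) (fun _ => hμ _)

/-! ### Functions of negative type -/

/-- A function `N` on an abelian group is of negative type if `N 0 = 0` and the kernel
`N x + N y - N (x - y)` is positive semidefinite. By the symmetry of the kernel such a function
is even, and this is the usual conditional negative definiteness of `N (x - y)`, with the
base point `0` used to turn it into a condition on a positive semidefinite kernel. -/
def IsNegativeType {G : Type*} [AddCommGroup G] (N : G → ℝ) : Prop :=
  N 0 = 0 ∧ (Matrix.of fun x y => N x + N y - N (x - y)).PosSemidef

namespace IsNegativeType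

variable {G : Type*} [AddCommGroup G]

theorem comp {G' : Type*} [AddCommGroup G'] {N : G → ℝ} (hN : IsNegativeType N) (f : G' →+ G) :
    IsNegativeType (fun x => N (f x)) := by
  refine ⟨by simp [hN.1], ?_⟩
  convert hN.2.submatrix f using 1
  ext x y
  simp

theorem zero : IsNegativeType (fun _ : G => 0) := by
  refine ⟨rfl, ?_⟩
  convert Matrix.PosSemidef.zero (n := G) (R := ℝ) using 1
  ext; simp

theorem add {N₁ N₂ : G → ℝ} (h₁ : IsNegativeType N₁) (h₂ : IsNegativeType N₂) :
    IsNegativeType (fun x => N₁ x + N₂ x) := by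
  refine ⟨by simp [h₁.1, h₂.1], ?_⟩
  convert h₁.2.add h₂.2 using 1
  ext; simp; ring

theorem mul_const {N : G → ℝ} (h : IsNegativeType N) {c : ℝ} (hc : 0 ≤ c) :
    IsNegativeType (fun x => N x * c) := by
  refine ⟨by simp [h.1], ?_⟩
  convert h.2.smul hc using 1
  ext; simp; ring

theorem sum {ι : Type*} {N : ι → G → ℝ} (h : ∀ i, IsNegativeType (N i)) (s : Finset ι) :
    IsNegativeType (fun x => ∑ i ∈ s, N i x) := by
  classical
  induction s using Finset.induction_on with
  | empty => simpa using zero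
  | insert i s hi ih => simpa [Finset.sum_insert hi] using (h i).add ih

theorem of_tendsto {α : Type*} {l : Filter α} [l.NeBot] {N : α → G → ℝ} {L : G → ℝ}
    (hN : ∀ a, IsNegativeType (N a)) (h : ∀ x, Filter.Tendsto (fun a => N a x) l (𝓝 (L x))) :
    IsNegativeType L := by
  refine ⟨tendsto_nhds_unique ((h 0).congr fun a => (hN a).1) tendsto_const_nhds, ?_⟩
  exact Matrix.PosSemidef.of_tendsto (fun a => (hN a).2)
    fun x y => ((h x).add (h y)).sub (h (x - y))

theorem of_hasSum {ι : Type*} {N : ι → G → ℝ} {L : G → ℝ}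
    (hN : ∀ i, IsNegativeType (N i)) (h : ∀ x, HasSum (fun i => N i x) (L x)) :
    IsNegativeType L :=
  of_tendsto (l := Filter.atTop) (fun s : Finset ι => sum hN s) h

theorem integral {Ω : Type*} [MeasurableSpace Ω] {μ : MeasureTheory.Measure Ω} {N : Ω → G → ℝ}
    (hN : ∀ ω, IsNegativeType (N ω)) (hi : ∀ x, MeasureTheory.Integrable (fun ω => N ω x) μ) :
    IsNegativeType (fun x => ∫ ω, N ω x ∂μ) := by
  refine ⟨by simp [(hN _).1], Matrix.IsHermitian.ext fun x y => ?_, fun c => ?_⟩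
  · have : ∀ ω, N ω (y - x) = N ω (x - y) := fun ω => by
      have := (hN ω).2.isHermitian.apply x y
      simp at this
      linarith
    simp [this, add_comm]
  · have : (c.sum fun x a => c.sum fun y b => star a *
        Matrix.of (fun x y => ∫ ω, N ω x ∂μ + ∫ ω, N ω y ∂μ - ∫ ω, N ω (x - y) ∂μ) x y * b) =
        ∫ ω, (c.sum fun x a => c.sum fun y b => star a *
          Matrix.of (fun x y => N ω x + N ω y - N ω (x - y)) x y * b) ∂μ := by
      have hxy : ∀ x y, MeasureTheory.Integrable (fun ω => N ω x + N ω y - N ω (x - y)) μ :=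
        fun x y => ((hi x).add (hi y)).sub (hi _)
      simp only [Finsupp.sum, Matrix.of_apply]
      rw [MeasureTheory.integral_finsetSum _ fun x _ => MeasureTheory.integrable_finsetSum _
        fun y _ => ((hxy x y).const_mul _).mul_const _]
      refine Finset.sum_congr rfl fun x _ => ?_
      rw [MeasureTheory.integral_finsetSum _ fun y _ => ((hxy x y).const_mul _).mul_const _]
      refine Finset.sum_congr rfl fun y _ => ?_
      rw [MeasureTheory.integral_mul_const, MeasureTheory.integral_const_mul,
        ← MeasureTheory.integral_add (hi x) (hi y),
        ← MeasureTheory.integral_sub (f := fun ω => N ω x + N ω y) ((hi x).add (hi y)) (hi _)]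
    rw [this]
    exact MeasureTheory.integral_nonneg fun ω => (hN ω).2.2 c

/-- Schoenberg's theorem, in the direction needed here. -/
theorem posSemidef_exp_neg {N : G → ℝ} (hN : IsNegativeType N) :
    (Matrix.of fun x y => Real.exp (-N (x - y))).PosSemidef := by
  have h := hN.2.exp_entrywise.hadamard (Matrix.posSemidef_rankOne fun x => Real.exp (-N x))
  have heq : (Matrix.of fun x y => Real.exp (-N (x - y))) =
      ((Matrix.of fun x y => N x + N y - N (x - y)).map Real.exp).hadamard
        (Matrix.of fun x y => Real.exp (-N x) * Real.exp (-N y)) := by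
    ext x y
    simp only [Matrix.of_apply, Matrix.hadamard_apply, Matrix.map_apply, ← Real.exp_add]
    congr 1
    ring
  rw [heq]
  exact h

/-- The kernel `|s| + |t| - |s - t|` is twice the length of the overlap of the oriented intervals
from `0` to `s` and from `0` to `t`. -/
theorem abs : IsNegativeType (fun t : ℝ => |t|) := by
  refine ⟨abs_zero, ?_⟩
  have h₁ := Matrix.posSemidef_measure_inter' MeasureTheory.volume
    (s := fun t : ℝ => Set.Ioc 0 t) (fun _ => measurableSet_Ioc) (by simp)
  have h₂ := Matrix.posSemidef_measure_inter' MeasureTheory.volume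
    (s := fun t : ℝ => Set.Ioc t 0) (fun _ => measurableSet_Ioc) (by simp)
  convert (h₁.add h₂).smul (zero_le_two (α := ℝ)) using 1
  ext s t
  simp only [Matrix.of_apply, Matrix.smul_apply, Matrix.add_apply, Set.Ioc_inter_Ioc,
    Real.volume_real_Ioc, smul_eq_mul]
  rcases le_total s t with h | h <;> rcases le_total 0 s with hs | hs <;>
    rcases le_total 0 t with ht | ht <;>
    simp [h, hs, ht, abs_of_nonneg, abs_of_nonpos] <;> linarith

end IsNegativeType

/-! ### Unitary representations from invariant kernels -/

/-- Moore's theorem: a positive semidefinite kernel is a Gram matrix of a total family in a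
complex Hilbert space. -/
theorem Matrix.PosSemidef.exists_gram {S : Type u} {K : Matrix S S ℝ} (hK : K.PosSemidef) :
    ∃ (H : Type u) (_ : NormedAddCommGroup H) (_ : InnerProductSpace ℂ H) (_ : CompleteSpace H)
      (κ : S → H), (∀ s t, inner ℂ (κ s) (κ t) = (K s t : ℂ)) ∧
        DenseRange (Finsupp.linearCombination ℂ κ) := by
  have hsymm : ∀ s t, K t s = K s t := fun s t => by simpa using hK.isHermitian.apply s t
  let M : Matrix S S (ℂ →L[ℂ] ℂ) := Matrix.of fun s t => (K s t : ℂ) • ContinuousLinearMap.id ℂ ℂ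
  have hM : Fact M.PosSemidef := by
    have htfae := (RKHS.posSemidef_tfae (K := M)).out 0 2
    refine ⟨htfae.2 ⟨Matrix.IsHermitian.ext fun s t => ?_, fun f => ?_⟩⟩
    · ext
      simp [M, hsymm s t, ContinuousLinearMap.star_eq_adjoint, ContinuousLinearMap.adjoint_id]
    · -- the real and the imaginary part of the coefficients contribute separately
      have hre := hK.2 (f.mapRange Complex.re (by simp))
      have him := hK.2 (f.mapRange Complex.im (by simp))
      rw [Finsupp.sum_mapRange_index (by simp)] at hre him
      simp only [Finsupp.sum_mapRange_index, mul_zero, implies_true] at hre him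
      refine (add_nonneg hre him).trans_eq ?_
      simp only [Finsupp.sum, ← Finset.sum_add_distrib, map_sum]
      refine Finset.sum_congr rfl fun s _ => Finset.sum_congr rfl fun t _ => ?_
      simp [M, hsymm s t]
      ring
  refine ⟨RKHS.OfKernel M, inferInstance, inferInstance, inferInstance,
    fun s => RKHS.kerFun (RKHS.OfKernel M) s 1, fun s t => ?_, ?_⟩
  · rw [← RKHS.kernel_inner, RKHS.OfKernel.kernel_ofKernel]
    simp [M, hsymm s t]
  · have h := RKHS.kerFun_dense (RKHS.OfKernel M)
    rw [DenseRange, ← LinearMap.coe_range, Finsupp.range_linearCombination,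
      Submodule.dense_iff_topologicalClosure_eq_top, ← h]
    congr 1
    refine le_antisymm (Submodule.span_le.2 ?_) (Submodule.span_le.2 ?_)
    · rintro _ ⟨s, rfl⟩
      exact Submodule.subset_span ⟨s, 1, rfl⟩
    · rintro _ ⟨s, v, rfl⟩
      have : v • RKHS.kerFun (RKHS.OfKernel M) s 1 = RKHS.kerFun (RKHS.OfKernel M) s v := by
        rw [← map_smul, smul_eq_mul, mul_one]
      exact this ▸ Submodule.smul_mem _ v (Submodule.subset_span ⟨s, rfl⟩)

/-- A permutation of a total family that preserves its Gram matrix extends to a unitary operator. -/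
theorem exists_linearIsometryEquiv_of_gram {S H : Type*} [NormedAddCommGroup H]
    [InnerProductSpace ℂ H] [CompleteSpace H] {κ : S → H}
    (hκ : DenseRange (Finsupp.linearCombination ℂ κ)) (σ : Equiv.Perm S)
    (hσ : ∀ s t, inner ℂ (κ (σ s)) (κ (σ t)) = inner ℂ (κ s) (κ t)) :
    ∃ T : H ≃ₗᵢ[ℂ] H, ∀ s, T (κ s) = κ (σ s) := by
  let e : (S →₀ ℂ) →ₗ[ℂ] H := Finsupp.linearCombination ℂ κ
  let σ' : (S →₀ ℂ) ≃ₗ[ℂ] (S →₀ ℂ) := Finsupp.domLCongr σ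
  have hnorm : ∀ f : S →₀ ℂ, ‖e (σ' f)‖ = ‖e f‖ := by
    intro f
    have : inner ℂ (e (σ' f)) (e (σ' f)) =
        inner ℂ (e f) (e f) := by
      simp only [e, σ', Finsupp.linearCombination_apply, Finsupp.domLCongr_apply,
        Finsupp.domCongr_apply, Finsupp.sum_equivMapDomain, Finsupp.sum_inner, Finsupp.inner_sum,
        inner_smul_left, inner_smul_right, hσ]
    rw [@norm_eq_sqrt_re_inner ℂ, this, ← @norm_eq_sqrt_re_inner ℂ]
  refine ⟨LinearEquiv.extendOfIsometry σ' e e hκ hκ hnorm, fun s => ?_⟩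
  have := LinearEquiv.extendOfIsometry_eq σ' e e hκ hκ hnorm
    (Finsupp.single s 1)
  simpa [e, σ'] using this

theorem LinearIsometryEquiv.ext_of_total {S H : Type*} [NormedAddCommGroup H]
    [InnerProductSpace ℂ H] {κ : S → H} (hκ : DenseRange (Finsupp.linearCombination ℂ κ)) {T T' : H ≃ₗᵢ[ℂ] H}
    (h : ∀ s, T (κ s) = T' (κ s)) : T = T' := by
  ext x
  refine congrFun (hκ.equalizer T.continuous T'.continuous ?_) x
  ext f
  simp [Finsupp.linearCombination_apply, map_finsuppSum, h]

/-- An abelian topological group is unitarily representable as soon as its topology at `0` is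
given by continuous functions of negative type. -/
theorem unitarilyRepresentable_of_isNegativeType {G : Type u} [AddCommGroup G] [TopologicalSpace G]
    [IsTopologicalAddGroup G] [T2Space G]
    (h : ∀ U ∈ 𝓝 (0 : G), ∃ N : G → ℝ, Continuous N ∧ IsNegativeType N ∧
      ∃ ε > 0, ∀ g, N g < ε → g ∈ U) : UnitarilyRepresentable (Multiplicative G) := by
  classical
  choose! N hNc hN ε hε hNU using h
  let ι : Type u := {U : Set G // U ∈ 𝓝 (0 : G)}
  -- one kernel for all neighbourhoods: blocks indexed by `ι`, orthogonal to each other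
  let K : Matrix (ι × G) (ι × G) ℝ :=
    Matrix.of fun s t => if s.1 = t.1 then Real.exp (-N s.1 (s.2 - t.2)) else 0
  have hK : K.PosSemidef := by
    have hblock : ∀ i : ι, (Matrix.of fun s t : ι × G => (if s.1 = i then (1 : ℝ) else 0) *
        (if t.1 = i then 1 else 0) * Real.exp (-N i (s.2 - t.2))).PosSemidef := fun i =>
      (Matrix.posSemidef_rankOne fun s : ι × G => if s.1 = i then (1 : ℝ) else 0).hadamard
        ((hN i i.2).posSemidef_exp_neg.submatrix Prod.snd)
    refine Matrix.PosSemidef.of_tendsto (l := Filter.atTop)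
      (M := fun J : Finset ι => ∑ i ∈ J, Matrix.of fun s t : ι × G =>
        (if s.1 = i then (1 : ℝ) else 0) * (if t.1 = i then 1 else 0) *
          Real.exp (-N i (s.2 - t.2)))
      (fun J => Matrix.posSemidef_sum _ fun i _ => hblock i) fun s t => ?_
    simp only [Matrix.sum_apply, Matrix.of_apply]
    change HasSum (fun i : ι => (if s.1 = i then (1 : ℝ) else 0) *
        (if t.1 = i then 1 else 0) * Real.exp (-N i (s.2 - t.2))) _
    have := hasSum_single (f := fun i : ι => (if s.1 = i then (1 : ℝ) else 0) *
        (if t.1 = i then 1 else 0) * Real.exp (-N i (s.2 - t.2))) s.1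
      fun i hi => by simp [hi.symm]
    convert this using 1
    by_cases hst : s.1 = t.1
    · simp [K, hst]
    · simp [K, hst, Ne.symm hst]
  obtain ⟨H, _, _, _, κ, hκK, hκ⟩ := hK.exists_gram
  have hT : ∀ g : G, ∃ T : H ≃ₗᵢ[ℂ] H, ∀ s : ι × G, T (κ s) = κ (s.1, g + s.2) := fun g =>
    exists_linearIsometryEquiv_of_gram hκ ((Equiv.refl ι).prodCongr (Equiv.addLeft g))
      fun s t => by simp [hκK, K]
  choose T hT using hT
  let ρ₀ : Multiplicative G →* (H ≃ₗᵢ[ℂ] H) :=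
    { toFun := fun g => T g.toAdd
      map_one' := LinearIsometryEquiv.ext_of_total hκ fun s => by simp [hT]
      map_mul' := fun g g' => LinearIsometryEquiv.ext_of_total hκ fun s => by simp [hT, add_assoc] }
  let ρ : Multiplicative G →* StrongUnitaryGroup H :=
    (Unitary.linearIsometryEquiv (𝕜 := ℂ) (H := H)).symm.toMonoidHom.comp ρ₀
  have hρ : ∀ g, StrongUnitaryGroup.toFun (ρ g) = T g.toAdd := fun g => rfl
  have hTadd : ∀ g g' x, T (g + g') x = T g (T g' x) := fun g g' x =>
    DFunLike.congr_fun (ρ₀.map_mul (.ofAdd g) (.ofAdd g')) x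
  have hdist : ∀ g s, ‖T g (κ s) - κ s‖ ^ 2 = 2 - 2 * Real.exp (-N s.1 g) := by
    intro g s
    rw [@norm_sub_sq ℂ, LinearIsometryEquiv.norm_map, hT, hκK, ← @inner_self_eq_norm_sq ℂ, hκK]
    simp only [K, Matrix.of_apply, if_true, sub_self, (hN s.1 s.1.2).1, neg_zero, Real.exp_zero,
      add_sub_cancel_right, RCLike.re_to_complex, Complex.ofReal_re]
    ring
  have hdist' : ∀ g g' s, ‖T g (κ s) - T g' (κ s)‖ ^ 2 = 2 - 2 * Real.exp (-N s.1 (g - g')) := by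
    intro g g' s
    have : T g (κ s) = T g' (T (g - g') (κ s)) := by rw [← hTadd, add_sub_cancel]
    rw [this, ← map_sub, LinearIsometryEquiv.norm_map, hdist]
  have hcontκ : ∀ s, Continuous fun g => T g (κ s) := by
    refine fun s => continuous_iff_continuousAt.2 fun g' => ?_
    rw [ContinuousAt, tendsto_iff_norm_sub_tendsto_zero]
    have hN0 : Continuous (N s.1) := hNc s.1 s.1.2
    have hc : Continuous fun g => √(2 - 2 * Real.exp (-N s.1 (g - g'))) := by fun_prop
    have h0 := hc.tendsto g'
    simp only [sub_self, (hN s.1 s.1.2).1, neg_zero, Real.exp_zero, mul_one, Real.sqrt_zero] at h0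
    refine h0.congr fun g => ?_
    rw [← hdist', Real.sqrt_sq (norm_nonneg _)]
  have hcont : ∀ x, Continuous fun g => T g x := by
    refine fun x => continuous_of_uniform_approx_of_continuous fun u hu => ?_
    obtain ⟨δ, hδ, hδu⟩ := Metric.mem_uniformity_dist.1 hu
    obtain ⟨f, hf⟩ := hκ.exists_dist_lt x hδ
    refine ⟨fun g => T g (Finsupp.linearCombination ℂ κ f), ?_, fun g => hδu ?_⟩
    · simp only [Finsupp.linearCombination_apply, Finsupp.sum, map_sum, map_smul]
      exact continuous_finsetSum _ fun s _ => (hcontκ s).const_smul _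
    · rwa [LinearIsometryEquiv.dist_map]
  refine ⟨H, inferInstance, inferInstance, inferInstance, ρ, ?_⟩
  have hcρ : Continuous ρ := continuous_induced_rng.2 (continuous_pi fun x => hcont x)
  have hind : IsInducing ρ := by
    refine isInducing_iff_nhds.2 fun g => le_antisymm hcρ.continuousAt.le_comap fun U hU => ?_
    have hV : {h : G | Multiplicative.ofAdd (g.toAdd + h) ∈ U} ∈ 𝓝 (0 : G) := by
      have hc : Continuous fun h : G => Multiplicative.ofAdd (g.toAdd + h) :=
        continuous_ofAdd.comp (continuous_const.add continuous_id)
      refine hc.continuousAt.preimage_mem_nhds ?_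
      simpa using hU
    let s : ι × G := (⟨_, hV⟩, 0)
    have hev : Continuous fun A : StrongUnitaryGroup H =>
        ‖A.toFun (κ s) - (ρ g).toFun (κ s)‖ ^ 2 := by
      have : Continuous fun A : StrongUnitaryGroup H => A.toFun (κ s) :=
        (continuous_apply (κ s)).comp continuous_induced_dom
      exact (this.sub continuous_const).norm.pow 2
    have hpos : (0 : ℝ) < 2 - 2 * Real.exp (-ε s.1) := by
      have : Real.exp (-ε s.1) < 1 := Real.exp_lt_one_iff.2 (neg_lt_zero.2 (hε s.1 s.1.2))
      linarith
    refine Filter.mem_comap.2 ⟨{A | ‖A.toFun (κ s) - (ρ g).toFun (κ s)‖ ^ 2 <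
      2 - 2 * Real.exp (-ε s.1)}, (isOpen_lt hev continuous_const).mem_nhds (by simpa using hpos),
      fun g' hg' => ?_⟩
    have hlt : ‖T g'.toAdd (κ s) - T g.toAdd (κ s)‖ ^ 2 < 2 - 2 * Real.exp (-ε s.1) := hg'
    rw [hdist'] at hlt
    have hlt' : Real.exp (-ε s.1) < Real.exp (-N s.1 (g'.toAdd - g.toAdd)) := by linarith
    have := hNU s.1 s.1.2 _ (neg_lt_neg_iff.1 (Real.exp_lt_exp.1 hlt'))
    simpa [s] using this
  have : T2Space (Multiplicative G) := inferInstanceAs (T2Space G)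
  exact hind.isEmbedding

/-! ### Random partitions of a seminormed family -/

section LeastWithin

variable {X V : Type*} [LinearOrder X] [WellFoundedLT X] [AddCommGroup V]
  (p : AddGroupSeminorm V) (e : X → V)

open Classical in
/-- The least index `α`, in a well-ordering of the index set, such that `e α` is at distance less
than `t` from `e x`. It is only used for `0 < t`, where such an index exists. For fixed `t` the
fibres of this function of `x` form a partition of the index set into sets of diameter at most
`2 * t`. -/
noncomputable def leastWithin (x : X) (t : ℝ) : X :=
  if h : {α | p (e x - e α) < t}.Nonempty then wellFounded_lt.min _ h else x

variable {p e} {x : X} {t t' : ℝ}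

theorem apply_sub_leastWithin_lt (x : X) (ht : 0 < t) : p (e x - e (leastWithin p e x t)) < t := by
  have h : {α | p (e x - e α) < t}.Nonempty := ⟨x, by simpa using ht⟩
  rw [leastWithin, dif_pos h]
  exact wellFounded_lt.min_mem _ h

theorem leastWithin_le {α : X} (h : p (e x - e α) < t) : leastWithin p e x t ≤ α := by
  have hne : {α | p (e x - e α) < t}.Nonempty := ⟨α, h⟩
  rw [leastWithin, dif_pos hne]
  exact not_lt.1 (WellFounded.not_lt_min wellFounded_lt {α | p (e x - e α) < t} h)

theorem leastWithin_anti (x : X) (ht : 0 < t) (h : t ≤ t') :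
    leastWithin p e x t' ≤ leastWithin p e x t :=
  leastWithin_le ((apply_sub_leastWithin_lt x ht).trans_le h)

theorem exists_leastWithin_eq_left (x : X) (ht : 0 < t) :
    ∃ a, 0 < a ∧ a < t ∧ ∀ s, a < s → s ≤ t → leastWithin p e x s = leastWithin p e x t := by
  obtain ⟨a, ha, hat⟩ := exists_between
    (max_lt ht (apply_sub_leastWithin_lt (p := p) (e := e) x ht))
  rw [max_lt_iff] at ha
  exact ⟨a, ha.1, hat, fun s hs hst => le_antisymm (leastWithin_le (ha.2.trans hs))
    (leastWithin_anti x (ha.1.trans hs) hst)⟩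

/-- A discontinuity `t` of `leastWithin p e x` is the maximum of its fibre, and the fibre contains
a rational number. -/
theorem countable_not_eventually_leastWithin_eq (x : X) :
    {t : ℝ | 0 < t ∧ ¬ ∀ᶠ s in 𝓝 t, leastWithin p e x s = leastWithin p e x t}.Countable := by
  refine (Set.countable_range fun q : ℚ =>
    sSup {s : ℝ | leastWithin p e x s = leastWithin p e x q ∧ 0 < s}).mono ?_
  rintro t ⟨ht, hbad⟩
  obtain ⟨a, ha, hat, hleft⟩ := exists_leastWithin_eq_left (p := p) (e := e) x ht
  obtain ⟨q, haq, hqt⟩ := exists_rat_btwn hat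
  have hq := hleft q haq hqt.le
  refine ⟨q, IsGreatest.csSup_eq ⟨⟨hq.symm, ht⟩, fun s hs => ?_⟩⟩
  by_contra! hts
  refine hbad (Filter.mem_of_superset (Ioo_mem_nhds hat hts) fun r hr => ?_)
  rcases le_total r t with h | h
  · exact hleft r hr.1 h
  · refine le_antisymm (leastWithin_anti x ht h) ?_
    rw [← hq, ← hs.1]
    exact leastWithin_anti x (ht.trans_le h) hr.2.le

/-- Where `leastWithin p e x` is locally constant in the radius, it is also locally constant in the
point, because `leastWithin p e y t` lies between the values of `leastWithin p e x` at
`t + p (e y - e x)` and `t - p (e y - e x)`. -/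
theorem exists_leastWithin_eq_of_eventually (ht : 0 < t)
    (h : ∀ᶠ s in 𝓝 t, leastWithin p e x s = leastWithin p e x t) :
    ∃ δ > 0, ∀ y, p (e y - e x) < δ → leastWithin p e y t = leastWithin p e x t := by
  obtain ⟨δ, hδ, hball⟩ := Metric.eventually_nhds_iff.1 h
  refine ⟨min δ t, lt_min hδ ht, fun y hy => ?_⟩
  rw [lt_min_iff] at hy
  have hr : 0 ≤ p (e y - e x) := apply_nonneg p _
  have htri : ∀ a b c : X, p (e a - e c) ≤ p (e a - e b) + p (e b - e c) := fun a b c => by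
    simpa using map_add_le_add p (e a - e b) (e b - e c)
  refine le_antisymm ?_ ?_
  · rw [← hball (y := t - p (e y - e x)) (by simpa [Real.dist_eq, abs_of_nonneg hr] using hy.1)]
    refine leastWithin_le ((htri y x _).trans_lt ?_)
    have := apply_sub_leastWithin_lt (p := p) (e := e) x (sub_pos.2 hy.2)
    linarith
  · rw [← hball (y := t + p (e y - e x)) (by simpa [Real.dist_eq, abs_of_nonneg hr] using hy.1)]
    refine leastWithin_le ((htri x y _).trans_lt ?_)
    have := apply_sub_leastWithin_lt (p := p) (e := e) y ht
    rw [map_sub_rev p (e x) (e y)]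
    linarith

end LeastWithin

section Stage

variable {X V : Type*} [LinearOrder X] [WellFoundedLT X] [AddCommGroup V]
  (p : AddGroupSeminorm V) (e : X → V)

/-- The vector attached to an optional index; a missing index stands for the zero vector. -/
def optionVector : Option X → V := fun a => a.elim 0 e

/-- The successive approximations of the index `x`, for a value `t` of the random parameter in
`(0, 1)`: no index at all, then indices of vectors at distance less than `t / 2 ^ n`
from `e x`. -/
noncomputable def stage (t : ℝ) : ℕ → X → Option X
  | 0, _ => none
  | n + 1, x => some (leastWithin p e x (t * (1 / 2) ^ n))

/-- Two successive approximations of an index. -/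
noncomputable def stagePair (t : ℝ) (n : ℕ) (x : X) : Option X × Option X :=
  (stage p e t n x, stage p e t (n + 1) x)

/-- The difference vector of a pair of optional indices. -/
def pairVector : Option X × Option X → V := fun j => optionVector e j.1 - optionVector e j.2

variable {p e}

theorem apply_sub_stage_lt {t : ℝ} (ht : t ∈ Set.Ioo (0 : ℝ) 1) (n : ℕ) (x : X) :
    p (e x - optionVector e (stage p e t (n + 1) x)) < (1 / 2) ^ n :=
  (apply_sub_leastWithin_lt x (mul_pos ht.1 (by positivity))).trans
    (mul_lt_of_lt_one_left (by positivity) ht.2)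

theorem apply_pairVector_stagePair_le {t : ℝ} (ht : t ∈ Set.Ioo (0 : ℝ) 1) (n : ℕ) (x : X) :
    p (pairVector e (stagePair p e t n x)) ≤ (p (e x) + 4) * (1 / 2) ^ n := by
  have hx : 0 ≤ p (e x) := apply_nonneg p _
  cases n with
  | zero =>
    have h := apply_sub_stage_lt (p := p) (e := e) ht 0 x
    have h2 := map_sub_le_add p (e x) (e x - optionVector e (stage p e t 1 x))
    simp only [pairVector, stagePair, stage, optionVector, Option.elim, zero_sub,
      map_neg_eq_map, sub_sub_cancel] at h h2 ⊢
    simp only [pow_zero] at h h2 ⊢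
    linarith
  | succ n =>
    have h₁ := apply_sub_stage_lt (p := p) (e := e) ht n x
    have h₂ := apply_sub_stage_lt (p := p) (e := e) ht (n + 1) x
    have h3 := map_sub_le_add p (e x - optionVector e (stage p e t (n + 1 + 1) x))
      (e x - optionVector e (stage p e t (n + 1) x))
    rw [sub_sub_sub_cancel_left] at h3
    have hpos : (0 : ℝ) < (1 / 2) ^ n := by positivity
    rw [pow_succ] at h₂ ⊢
    simp only [pairVector, stagePair]
    nlinarith

theorem ae_stage (n : ℕ) (x : X) : ∀ᵐ t ∂MeasureTheory.volume.restrict (Set.Ioo (0 : ℝ) 1),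
    (∀ᶠ s in 𝓝 t, stage p e s n x = stage p e t n x) ∧
      ∃ δ > 0, ∀ y, p (e y - e x) < δ → stage p e t n y = stage p e t n x := by
  cases n with
  | zero =>
    exact Filter.Eventually.of_forall fun t => ⟨by simp [stage], 1, one_pos, by simp [stage]⟩
  | succ n =>
    have hc : (0 : ℝ) < (1 / 2) ^ n := by positivity
    have hcount := (countable_not_eventually_leastWithin_eq (p := p) (e := e) x).preimage_of_injOn
      (f := fun t : ℝ => t * (1 / 2) ^ n) (mul_left_injective₀ hc.ne').injOn
    filter_upwards [MeasureTheory.ae_restrict_of_ae (hcount.ae_notMem MeasureTheory.volume),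
      MeasureTheory.ae_restrict_mem measurableSet_Ioo] with t hbad ht
    have ht0 : 0 < t * (1 / 2) ^ n := mul_pos ht.1 hc
    have hev : ∀ᶠ s in 𝓝 (t * (1 / 2) ^ n),
        leastWithin p e x s = leastWithin p e x (t * (1 / 2) ^ n) := by
      by_contra h
      exact hbad ⟨ht0, h⟩
    refine ⟨?_, ?_⟩
    · have hcont : Continuous fun t : ℝ => t * (1 / 2) ^ n := by fun_prop
      filter_upwards [hcont.continuousAt.eventually hev] with s hs
      simpa only [stage, Option.some_inj] using hs
    · obtain ⟨δ, hδ, h⟩ := exists_leastWithin_eq_of_eventually ht0 hev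
      exact ⟨δ, hδ, fun y hy => by simpa only [stage, Option.some_inj] using h y hy⟩

theorem ae_stagePair (n : ℕ) (x : X) : ∀ᵐ t ∂MeasureTheory.volume.restrict (Set.Ioo (0 : ℝ) 1),
    (∀ᶠ s in 𝓝 t, stagePair p e s n x = stagePair p e t n x) ∧
      ∃ δ > 0, ∀ y, p (e y - e x) < δ → stagePair p e t n y = stagePair p e t n x := by
  filter_upwards [ae_stage (p := p) (e := e) n x, ae_stage (p := p) (e := e) (n + 1) x]
    with t ⟨h₁, δ₁, hδ₁, hy₁⟩ ⟨h₂, δ₂, hδ₂, hy₂⟩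
  refine ⟨?_, min δ₁ δ₂, lt_min hδ₁ hδ₂, fun y hy => ?_⟩
  · filter_upwards [h₁, h₂] with s hs₁ hs₂
    rw [stagePair, stagePair, hs₁, hs₂]
  · rw [lt_min_iff] at hy
    rw [stagePair, stagePair, hy₁ y hy.1, hy₂ y hy.2]

end Stage

/-! ### Weighted `ℓ¹` seminorms of images of finitely supported functions -/

section PushNorm

variable {X J R : Type*} [AddCommGroup R] (w : AddGroupSeminorm R) (W : J → ℝ) (ρ : X → J)

/-- The `ℓ¹` norm, with weights `W`, of the image of a finitely supported function under the map
`ρ`; the sizes of the coefficients are measured by `w`. -/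
noncomputable def pushNorm (v : X →₀ R) : ℝ :=
  (Finsupp.mapDomain ρ v).sum fun j a => w a * W j

variable {w W ρ}

theorem hasSum_pushNorm (v : X →₀ R) :
    HasSum (fun j => w (Finsupp.mapDomain ρ v j) * W j) (pushNorm w W ρ v) :=
  hasSum_sum_of_ne_finset_zero fun j hj => by simp [Finsupp.notMem_support_iff.1 hj]

theorem pushNorm_nonneg (hW : ∀ j, 0 ≤ W j) (v : X →₀ R) : 0 ≤ pushNorm w W ρ v :=
  Finset.sum_nonneg fun j _ => mul_nonneg (apply_nonneg w _) (hW j)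

@[simp] theorem pushNorm_zero : pushNorm w W ρ 0 = 0 := by simp [pushNorm]

theorem pushNorm_single (x : X) (a : R) :
    pushNorm w W ρ (Finsupp.single x a) = w a * W (ρ x) := by
  simp [pushNorm, Finsupp.mapDomain_single]

theorem pushNorm_add_le (hW : ∀ j, 0 ≤ W j) (v v' : X →₀ R) :
    pushNorm w W ρ (v + v') ≤ pushNorm w W ρ v + pushNorm w W ρ v' := by
  refine hasSum_le (fun j => ?_) (hasSum_pushNorm (v + v'))
    ((hasSum_pushNorm v).add (hasSum_pushNorm v'))
  rw [← add_mul, Finsupp.mapDomain_add, Finsupp.add_apply]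
  exact mul_le_mul_of_nonneg_right (map_add_le_add w _ _) (hW j)

theorem pushNorm_neg (v : X →₀ R) : pushNorm w W ρ (-v) = pushNorm w W ρ v := by
  refine (hasSum_pushNorm (-v)).unique ?_
  have : Finsupp.mapDomain ρ (-v) = -Finsupp.mapDomain ρ v :=
    map_neg (Finsupp.mapDomain.addMonoidHom ρ) v
  simpa [this] using hasSum_pushNorm v

theorem pushNorm_le_sum (hW : ∀ j, 0 ≤ W j) (v : X →₀ R) :
    pushNorm w W ρ v ≤ v.sum fun x a => w a * W (ρ x) := by
  have h := Finset.le_sum_of_subadditive (pushNorm w W ρ) pushNorm_zero.le (pushNorm_add_le hW)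
    v.support fun x => Finsupp.single x (v x)
  have hv : ∑ x ∈ v.support, Finsupp.single x (v x) = v := Finsupp.sum_single v
  simp only [hv, pushNorm_single] at h
  exact h

theorem pushNorm_congr {ρ' : X → J} {v : X →₀ R} (h : ∀ x ∈ v.support, ρ x = ρ' x) :
    pushNorm w W ρ v = pushNorm w W ρ' v := by
  rw [pushNorm, pushNorm, Finsupp.mapDomain_congr h]

theorem pushNorm_le_mul {w' : AddGroupSeminorm R} {C : ℝ} (hW : ∀ j, 0 ≤ W j)
    (h : ∀ a, w a ≤ C * w' a) (v : X →₀ R) : pushNorm w W ρ v ≤ C * pushNorm w' W ρ v := by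
  refine hasSum_le (fun j => ?_) (hasSum_pushNorm v) ((hasSum_pushNorm v).mul_left C)
  rw [← mul_assoc]
  exact mul_le_mul_of_nonneg_right (h _) (hW j)

theorem pushNorm_smul {S : Type*} [Monoid S] [DistribMulAction S R] {r : S} {c : ℝ}
    (h : ∀ a, w (r • a) = c * w a) (v : X →₀ R) :
    pushNorm w W ρ (r • v) = c * pushNorm w W ρ v := by
  refine (hasSum_pushNorm (r • v)).unique ?_
  simpa [Finsupp.mapDomain_smul, h, mul_assoc] using (hasSum_pushNorm v).mul_left c

theorem isNegativeType_pushNorm (hw : IsNegativeType w) (hW : ∀ j, 0 ≤ W j) :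
    IsNegativeType (pushNorm w W ρ) :=
  IsNegativeType.of_hasSum (fun j => (hw.comp ((Finsupp.applyAddHom j).comp
    (Finsupp.mapDomain.addMonoidHom ρ))).mul_const (hW j)) hasSum_pushNorm

theorem apply_linearCombination_le {R V : Type*} [Ring R] [AddCommGroup V] [Module R V]
    {w : AddGroupSeminorm R} {p : AddGroupSeminorm V} (hp : ∀ (r : R) a, p (r • a) ≤ w r * p a)
    (f : J → V) (b : J →₀ R) :
    p (Finsupp.linearCombination R f b) ≤ b.sum fun j a => w a * p (f j) := by
  rw [Finsupp.linearCombination_apply]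
  exact (Finset.le_sum_of_subadditive p (map_zero p).le (map_add_le_add p) _ _).trans
    (Finset.sum_le_sum fun j _ => hp _ _)

end PushNorm

/-! ### The dominating function of negative type -/

open MeasureTheory in
theorem MeasureTheory.aestronglyMeasurable_of_ae_eventually_eq {α β : Type*} [TopologicalSpace α]
    [MeasurableSpace α] [OpensMeasurableSpace α] [SecondCountableTopology α]
    [TopologicalSpace β] [TopologicalSpace.PseudoMetrizableSpace β] {μ : Measure α} {g : α → β}
    (h : ∀ᵐ t ∂μ, ∀ᶠ s in 𝓝 t, g s = g t) : AEStronglyMeasurable g μ := by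
  have hopen : IsOpen {t | ∀ᶠ s in 𝓝 t, g s = g t} := by
    refine isOpen_iff_mem_nhds.2 fun t ht => ?_
    filter_upwards [eventually_eventually_nhds.2 ht, ht] with s hs hst
    filter_upwards [hs] with r hr
    rw [hr, hst]
  have hcont : ContinuousOn g {t | ∀ᶠ s in 𝓝 t, g s = g t} := fun t ht =>
    ((continuousAt_const (y := g t)).congr (ht.mono fun _ => Eq.symm)).continuousWithinAt
  rw [← Measure.restrict_eq_self_of_ae_mem h]
  exact hcont.aestronglyMeasurable hopen.measurableSet

section PartitionNorm

open MeasureTheory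

variable {X V R : Type*} [LinearOrder X] [WellFoundedLT X] [AddCommGroup V] [AddCommGroup R]
  (p : AddGroupSeminorm V) (e : X → V) (w : AddGroupSeminorm R)

/-- The contribution of the value `t` of the random parameter and of scale `n` to
`partitionNorm`. -/
noncomputable def partitionLevel (t : ℝ) (n : ℕ) (v : X →₀ R) : ℝ :=
  pushNorm w (fun j => p (pairVector e j)) (stagePair p e t n) v

/-- For a seminormed family `e`, the sum over all scales of the mean weighted `ℓ¹` norms of the
images of `v` under the random maps `stagePair p e t n`. -/
noncomputable def partitionNorm (v : X →₀ R) : ℝ :=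
  ∑' n, ∫ t in Set.Ioo (0 : ℝ) 1, partitionLevel p e w t n v

variable {p e w}

theorem partitionLevel_nonneg (t : ℝ) (n : ℕ) (v : X →₀ R) : 0 ≤ partitionLevel p e w t n v :=
  pushNorm_nonneg (fun _ => apply_nonneg p _) v

theorem partitionLevel_le {t : ℝ} (ht : t ∈ Set.Ioo (0 : ℝ) 1) (n : ℕ) (v : X →₀ R) :
    partitionLevel p e w t n v ≤ (v.sum fun x a => w a * (p (e x) + 4)) * (1 / 2) ^ n := by
  refine (pushNorm_le_sum (fun _ => apply_nonneg p _) v).trans ?_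
  rw [Finsupp.sum, Finsupp.sum, Finset.sum_mul]
  refine Finset.sum_le_sum fun x _ => ?_
  rw [mul_assoc]
  exact mul_le_mul_of_nonneg_left (apply_pairVector_stagePair_le ht n x) (apply_nonneg w _)

theorem aestronglyMeasurable_partitionLevel (n : ℕ) (v : X →₀ R) :
    AEStronglyMeasurable (fun t => partitionLevel p e w t n v)
      (volume.restrict (Set.Ioo (0 : ℝ) 1)) := by
  refine aestronglyMeasurable_of_ae_eventually_eq ?_
  have h := (Filter.eventually_all_finset v.support).2 fun x _ =>
    ae_stagePair (p := p) (e := e) n x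
  filter_upwards [h] with t ht
  filter_upwards [(Filter.eventually_all_finset v.support).2 fun x hx => (ht x hx).1] with s hs
  exact pushNorm_congr hs

theorem integrable_partitionLevel (n : ℕ) (v : X →₀ R) :
    IntegrableOn (fun t => partitionLevel p e w t n v) (Set.Ioo (0 : ℝ) 1) := by
  refine Integrable.of_bound (aestronglyMeasurable_partitionLevel n v)
    ((v.sum fun x a => w a * (p (e x) + 4)) * (1 / 2) ^ n) ?_
  filter_upwards [ae_restrict_mem measurableSet_Ioo] with t ht
  rw [Real.norm_of_nonneg (partitionLevel_nonneg t n v)]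
  exact partitionLevel_le ht n v

theorem integral_partitionLevel_nonneg (n : ℕ) (v : X →₀ R) :
    0 ≤ ∫ t in Set.Ioo (0 : ℝ) 1, partitionLevel p e w t n v :=
  integral_nonneg fun t => partitionLevel_nonneg t n v

theorem integral_partitionLevel_le {n : ℕ} {v : X →₀ R} {C : ℝ}
    (h : ∀ t ∈ Set.Ioo (0 : ℝ) 1, partitionLevel p e w t n v ≤ C) :
    ∫ t in Set.Ioo (0 : ℝ) 1, partitionLevel p e w t n v ≤ C := by
  have := setIntegral_mono_on (integrable_partitionLevel (p := p) (e := e) (w := w) n v)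
    (integrableOn_const (C := C) (by simp)) measurableSet_Ioo h
  simpa using this

theorem hasSum_partitionNorm (v : X →₀ R) :
    HasSum (fun n => ∫ t in Set.Ioo (0 : ℝ) 1, partitionLevel p e w t n v)
      (partitionNorm p e w v) := by
  have hle : ∀ n, ∫ t in Set.Ioo (0 : ℝ) 1, partitionLevel p e w t n v ≤
      (v.sum fun x a => w a * (p (e x) + 4)) * (1 / 2) ^ n := fun n =>
    integral_partitionLevel_le fun t ht => partitionLevel_le ht n v
  have hgeom : Summable fun n : ℕ => (v.sum fun x a => w a * (p (e x) + 4)) * (1 / 2) ^ n :=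
    summable_geometric_two.mul_left _
  exact (Summable.of_nonneg_of_le (fun n => integral_partitionLevel_nonneg n v) hle hgeom).hasSum

theorem isNegativeType_partitionNorm (hw : IsNegativeType w) :
    IsNegativeType (partitionNorm p e w) :=
  IsNegativeType.of_hasSum (fun n => IsNegativeType.integral
    (fun _ => isNegativeType_pushNorm hw fun _ => apply_nonneg p _)
    (integrable_partitionLevel n)) hasSum_partitionNorm

theorem partitionNorm_zero : partitionNorm p e w 0 = 0 := by
  simp [partitionNorm, partitionLevel]

theorem partitionNorm_neg (v : X →₀ R) : partitionNorm p e w (-v) = partitionNorm p e w v := by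
  simp [partitionNorm, partitionLevel, pushNorm_neg]

theorem partitionNorm_add_le (v v' : X →₀ R) :
    partitionNorm p e w (v + v') ≤ partitionNorm p e w v + partitionNorm p e w v' := by
  refine hasSum_le (fun n => ?_) (hasSum_partitionNorm _)
    ((hasSum_partitionNorm v).add (hasSum_partitionNorm v'))
  rw [← integral_add (integrable_partitionLevel n v) (integrable_partitionLevel n v')]
  exact integral_mono (integrable_partitionLevel n _)
    ((integrable_partitionLevel n v).add (integrable_partitionLevel n v'))
    fun t => pushNorm_add_le (fun _ => apply_nonneg p _) v v'

theorem partitionNorm_le_mul {w' : AddGroupSeminorm R} {C : ℝ} (h : ∀ a, w a ≤ C * w' a)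
    (v : X →₀ R) : partitionNorm p e w v ≤ C * partitionNorm p e w' v := by
  refine hasSum_le (fun n => ?_) (hasSum_partitionNorm _) ((hasSum_partitionNorm v).mul_left C)
  rw [← integral_const_mul]
  exact integral_mono (integrable_partitionLevel n _) ((integrable_partitionLevel n v).const_mul C)
    fun t => pushNorm_le_mul (fun _ => apply_nonneg p _) h v

theorem partitionNorm_smul {S : Type*} [Monoid S] [DistribMulAction S R] {r : S} {c : ℝ}
    (h : ∀ a, w (r • a) = c * w a) (v : X →₀ R) :
    partitionNorm p e w (r • v) = c * partitionNorm p e w v := by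
  simp only [partitionNorm, partitionLevel, pushNorm_smul h, integral_const_mul, tsum_mul_left]

/-- The point of the construction: `partitionNorm` depends continuously on the points of the
family. -/
theorem tendsto_partitionNorm_single_sub_single (a : R) (x : X) :
    Filter.Tendsto (fun y => partitionNorm p e w (Finsupp.single y a - Finsupp.single x a))
      (Filter.comap (fun y => p (e y - e x)) (𝓝 0)) (𝓝 0) := by
  have hlt : ∀ δ > 0, ∀ᶠ y in Filter.comap (fun y => p (e y - e x)) (𝓝 0), p (e y - e x) < δ :=
    fun δ hδ => Filter.tendsto_comap.eventually (gt_mem_nhds hδ)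
  have hbound : ∀ᶠ y in Filter.comap (fun y => p (e y - e x)) (𝓝 0),
      ∀ n, ∀ t ∈ Set.Ioo (0 : ℝ) 1, partitionLevel p e w t n
        (Finsupp.single y a - Finsupp.single x a) ≤ w a * (2 * p (e x) + 9) * (1 / 2) ^ n := by
    filter_upwards [hlt 1 one_pos] with y hy n t ht
    have hW : ∀ j, 0 ≤ p (pairVector e j) := fun j => apply_nonneg p _
    have h₁ := pushNorm_add_le (w := w) (ρ := stagePair p e t n) hW (Finsupp.single y a)
      (-Finsupp.single x a)
    rw [pushNorm_neg, pushNorm_single, pushNorm_single, ← sub_eq_add_neg] at h₁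
    have hx := apply_pairVector_stagePair_le (p := p) (e := e) ht n x
    have hy' := apply_pairVector_stagePair_le (p := p) (e := e) ht n y
    have hyx : p (e y) ≤ p (e x) + 1 := by
      have := map_add_le_add p (e x) (e y - e x)
      rw [add_sub_cancel] at this
      linarith
    have hwa : 0 ≤ w a := apply_nonneg w a
    have hpos : (0 : ℝ) < (1 / 2) ^ n := by positivity
    refine h₁.trans ?_
    rw [← mul_add, mul_assoc]
    refine mul_le_mul_of_nonneg_left ?_ hwa
    nlinarith
  have hlevel : ∀ n, Filter.Tendsto (fun y => ∫ t in Set.Ioo (0 : ℝ) 1, partitionLevel p e w t n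
      (Finsupp.single y a - Finsupp.single x a))
      (Filter.comap (fun y => p (e y - e x)) (𝓝 0)) (𝓝 0) := by
    intro n
    have := tendsto_integral_filter_of_dominated_convergence
      (μ := volume.restrict (Set.Ioo (0 : ℝ) 1))
      (l := Filter.comap (fun y => p (e y - e x)) (𝓝 0))
      (F := fun y t => partitionLevel p e w t n (Finsupp.single y a - Finsupp.single x a))
      (f := fun _ => 0) (fun _ => w a * (2 * p (e x) + 9) * (1 / 2) ^ n)
      (Filter.Eventually.of_forall fun y => aestronglyMeasurable_partitionLevel n _) ?_
      (integrable_const _) ?_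
    · simpa using this
    · filter_upwards [hbound] with y hy
      filter_upwards [ae_restrict_mem measurableSet_Ioo] with t ht
      rw [Real.norm_of_nonneg (partitionLevel_nonneg t n _)]
      exact hy n t ht
    · filter_upwards [ae_stagePair (p := p) (e := e) n x] with t ⟨_, δ, hδ, hy⟩
      refine tendsto_const_nhds.congr' ?_
      filter_upwards [hlt δ hδ] with y hyδ
      have h0 : Finsupp.mapDomain (stagePair p e t n) (Finsupp.single y a - Finsupp.single x a)
          = 0 := by
        rw [sub_eq_add_neg, ← Finsupp.single_neg, Finsupp.mapDomain_add, Finsupp.mapDomain_single,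
          Finsupp.mapDomain_single, hy y hyδ, ← Finsupp.single_add, add_neg_cancel,
          Finsupp.single_zero]
      simp [partitionLevel, pushNorm, h0]
  have := tendsto_tsum_of_dominated_convergence
    (bound := fun n : ℕ => w a * (2 * p (e x) + 9) * (1 / 2) ^ n)
    (summable_geometric_two.mul_left _) hlevel ?_
  · simpa [partitionNorm] using this
  · filter_upwards [hbound] with y hy n
    rw [Real.norm_of_nonneg (integral_partitionLevel_nonneg n _)]
    exact integral_partitionLevel_le fun t ht => hy n t ht

end PartitionNorm

open MeasureTheory in
/-- A finite linear combination is recovered from its successive approximations by a telescoping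
sum, whatever the value of the random parameter. -/
theorem apply_linearCombination_le_partitionNorm {X V R : Type*} [LinearOrder X] [WellFoundedLT X]
    [AddCommGroup V] [Ring R] [Module R V] {p : AddGroupSeminorm V} {e : X → V}
    {w : AddGroupSeminorm R} (hp : ∀ (r : R) a, p (r • a) ≤ w r * p a) (v : X →₀ R) :
    p (Finsupp.linearCombination R e v) ≤ partitionNorm p e w v := by
  let C : ℝ := v.sum fun _ a => w a
  let A : ℝ → ℕ → V := fun t n =>
    Finsupp.linearCombination R (fun x => optionVector e (stage p e t n x)) v
  have hstep : ∀ t n, p (A t n - A t (n + 1)) ≤ partitionLevel p e w t n v := by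
    intro t n
    have : A t n - A t (n + 1) = Finsupp.linearCombination R (pairVector e)
        (Finsupp.mapDomain (stagePair p e t n) v) := by
      rw [Finsupp.linearCombination_mapDomain]
      simp only [A, Finsupp.linearCombination_apply, Finsupp.sum, ← Finset.sum_sub_distrib,
        ← smul_sub]
      rfl
    rw [this]
    exact apply_linearCombination_le hp _ _
  have hA0 : ∀ t, A t 0 = 0 := fun t => by
    simp [A, Finsupp.linearCombination_apply, stage, optionVector]
  have htail : ∀ t ∈ Set.Ioo (0 : ℝ) 1, ∀ n,
      p (Finsupp.linearCombination R e v - A t (n + 1)) ≤ C * (1 / 2) ^ n := by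
    intro t ht n
    have : Finsupp.linearCombination R e v - A t (n + 1) = Finsupp.linearCombination R
        (fun x => e x - optionVector e (stage p e t (n + 1) x)) v := by
      simp only [A, Finsupp.linearCombination_apply, Finsupp.sum, ← Finset.sum_sub_distrib,
        ← smul_sub]
    rw [this]
    refine (apply_linearCombination_le hp _ _).trans ?_
    simp only [C, Finsupp.sum, Finset.sum_mul]
    exact Finset.sum_le_sum fun x _ =>
      mul_le_mul_of_nonneg_left (apply_sub_stage_lt ht n x).le (apply_nonneg w _)
  have hpartial : ∀ t n, p (A t n) ≤ ∑ k ∈ Finset.range n, partitionLevel p e w t k v := by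
    intro t n
    induction n with
    | zero => simp [hA0]
    | succ n ih =>
      rw [Finset.sum_range_succ]
      have h := map_sub_le_add p (A t n) (A t n - A t (n + 1))
      rw [sub_sub_cancel] at h
      linarith [hstep t n]
  have hmean : ∀ n, p (Finsupp.linearCombination R e v) ≤
      partitionNorm p e w v + C * (1 / 2) ^ n := by
    intro n
    have hpoint : ∀ t ∈ Set.Ioo (0 : ℝ) 1, p (Finsupp.linearCombination R e v) - C * (1 / 2) ^ n ≤
        ∑ k ∈ Finset.range (n + 1), partitionLevel p e w t k v := by
      intro t ht
      have h := map_add_le_add p (Finsupp.linearCombination R e v - A t (n + 1)) (A t (n + 1))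
      rw [sub_add_cancel] at h
      linarith [htail t ht n, hpartial t (n + 1)]
    have hint := setIntegral_mono_on (integrableOn_const (by simp))
      (integrable_finsetSum _ fun k _ => integrable_partitionLevel (p := p) (e := e) (w := w) k v)
      measurableSet_Ioo hpoint
    rw [integral_finsetSum _ fun k _ => integrable_partitionLevel k v] at hint
    have hsum := sum_le_hasSum (Finset.range (n + 1))
      (fun k _ => integral_partitionLevel_nonneg k v)
      (hasSum_partitionNorm (p := p) (e := e) (w := w) v)
    simp only [setIntegral_const, Real.volume_real_Ioo_of_le zero_le_one, sub_zero, one_smul]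
      at hint
    linarith
  have hlim : Filter.Tendsto (fun n : ℕ => partitionNorm p e w v + C * (1 / 2) ^ n)
      Filter.atTop (𝓝 (partitionNorm p e w v + C * 0)) :=
    ((tendsto_pow_atTop_nhds_zero_of_lt_one (by norm_num) (by norm_num)).const_mul C).const_add _
  rw [mul_zero, add_zero] at hlim
  exact ge_of_tendsto' hlim hmean

/-! ### Continuous seminorms on abelian topological groups -/

open scoped NNReal

/-- A neighbourhood of `0` in an abelian topological group contains a ball of a continuous group
seminorm. This is the Birkhoff–Kakutani construction: the seminorm is the largest one below a
gauge `φ` of a sequence of neighbourhoods `B n` with `B (n + 1) + B (n + 1) + B (n + 1) ⊆ B n`. -/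
theorem exists_continuous_addGroupSeminorm {G : Type*} [AddCommGroup G] [TopologicalSpace G]
    [IsTopologicalAddGroup G] {U : Set G} (hU : U ∈ 𝓝 0) :
    ∃ p : AddGroupSeminorm G, Continuous p ∧ ∃ ε > 0, ∀ g, p g < ε → g ∈ U := by
  classical
  have hstep : ∀ W : {W : Set G // W ∈ 𝓝 0}, ∃ W' : {W : Set G // W ∈ 𝓝 0},
      (∀ g ∈ W'.1, -g ∈ W'.1) ∧ ∀ a ∈ W'.1, ∀ b ∈ W'.1, ∀ c ∈ W'.1, a + b + c ∈ W.1 := by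
    rintro ⟨W, hW⟩
    obtain ⟨V, hV, hVW⟩ := exists_nhds_zero_quarter hW
    refine ⟨⟨V ∩ -V, Filter.inter_mem hV (neg_mem_nhds_zero G hV)⟩,
      fun g hg => ⟨hg.2, by simpa using hg.1⟩, fun a ha b hb c hc => ?_⟩
    simpa using hVW ha.1 hb.1 hc.1 (mem_of_mem_nhds hV)
  choose f hfneg hf using hstep
  let B : ℕ → {W : Set G // W ∈ 𝓝 0} := fun n => f^[n + 1] ⟨U, hU⟩
  have hBsucc : ∀ n, B (n + 1) = f (B n) := fun n => Function.iterate_succ_apply' f _ _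
  have hB0 : ∀ n, (0 : G) ∈ (B n).1 := fun n => mem_of_mem_nhds (B n).2
  have hBneg : ∀ n, ∀ g ∈ (B n).1, -g ∈ (B n).1 := fun n => by
    rw [show B n = f (f^[n] ⟨U, hU⟩) from Function.iterate_succ_apply' f _ _]
    exact hfneg _
  have hBadd : ∀ n, ∀ a ∈ (B (n + 1)).1, ∀ b ∈ (B (n + 1)).1, ∀ c ∈ (B (n + 1)).1,
      a + b + c ∈ (B n).1 := fun n => by
    rw [hBsucc]
    exact hf _
  have hBanti : Antitone fun n => (B n).1 := antitone_nat_of_succ_le fun n a ha => by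
    simpa using hBadd n a ha 0 (hB0 _) 0 (hB0 _)
  have hBU : (B 0).1 ⊆ U := fun a ha => by
    simpa using hf ⟨U, hU⟩ a ha 0 (hB0 0) 0 (hB0 0)
  let φ : G → ℝ≥0 := fun g => if h : ∃ n, g ∉ (B n).1 then (1 / 2) ^ Nat.find h else 0
  have hφ : ∀ g n, (1 / 2) ^ n ≤ φ g ↔ g ∉ (B n).1 := by
    intro g n
    by_cases h : ∃ n, g ∉ (B n).1
    · simp only [φ, dif_pos h]
      rw [pow_le_pow_iff_right_of_lt_one₀ (by norm_num) (by norm_num)]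
      exact ⟨fun hn hg => Nat.find_spec h (hBanti hn hg), fun hg => Nat.find_min' h hg⟩
    · simp only [φ, dif_neg h]
      push Not at h
      simp [h n]
  have hφ0 : φ 0 = 0 := dif_neg (by simpa using hB0)
  have hφneg : ∀ g, φ (-g) = φ g := by
    have : ∀ g n, -g ∉ (B n).1 ↔ g ∉ (B n).1 := fun g n =>
      not_congr ⟨fun h => by simpa using hBneg n _ h, hBneg n g⟩
    intro g
    simp only [φ, this]
  let d : G → G → ℝ≥0 := fun x y => φ (y - x)
  have hd0 : ∀ x, d x x = 0 := fun x => by simp [d, hφ0]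
  have hdsymm : ∀ x y, d x y = d y x := fun x y => by
    simp only [d]
    rw [← hφneg, neg_sub]
  have hd : ∀ x₁ x₂ x₃ x₄, d x₁ x₄ ≤ 2 * max (d x₁ x₂) (max (d x₂ x₃) (d x₃ x₄)) := by
    intro x₁ x₂ x₃ x₄
    by_cases h : ∃ n, x₄ - x₁ ∉ (B n).1
    · have hval : d x₁ x₄ = (1 / 2) ^ Nat.find h := dif_pos h
      have hmax : (1 / 2) ^ (Nat.find h + 1) ≤ max (d x₁ x₂) (max (d x₂ x₃) (d x₃ x₄)) := by
        by_contra! hlt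
        rw [max_lt_iff, max_lt_iff] at hlt
        have hmem : ∀ g, φ g < (1 / 2) ^ (Nat.find h + 1) → g ∈ (B (Nat.find h + 1)).1 :=
          fun g hg => not_not.1 fun hc => hg.not_ge ((hφ g _).2 hc)
        refine Nat.find_spec h ?_
        have := hBadd _ _ (hmem _ hlt.1) _ (hmem _ hlt.2.1) _ (hmem _ hlt.2.2)
        rwa [show x₂ - x₁ + (x₃ - x₂) + (x₄ - x₃) = x₄ - x₁ by abel] at this
      calc d x₁ x₄ = 2 * (1 / 2) ^ (Nat.find h + 1) := by rw [hval, pow_succ]; ring_nf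
        _ ≤ _ := mul_le_mul_of_nonneg_left hmax zero_le
    · simp [d, φ, dif_neg h]
  let I : PseudoMetricSpace G := PseudoMetricSpace.ofPreNNDist d hd0 hdsymm
  have hle : ∀ x y, I.dist x y ≤ d x y := PseudoMetricSpace.dist_ofPreNNDist_le d hd0 hdsymm
  have hge : ∀ x y, (d x y : ℝ) ≤ 2 * I.dist x y :=
    PseudoMetricSpace.le_two_mul_dist_ofPreNNDist d hd0 hdsymm hd
  have htrans : ∀ a x y, I.dist (a + x) (a + y) ≤ I.dist x y := by
    intro a x y
    refine NNReal.coe_le_coe.2 (le_ciInf fun l => ?_)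
    refine (ciInf_le (OrderBot.bddBelow _) (l.map (a + ·))).trans_eq ?_
    have h₁ : (a + x) :: l.map (a + ·) = (x :: l).map (a + ·) := rfl
    have h₂ : l.map (a + ·) ++ [a + y] = (l ++ [y]).map (a + ·) := by simp
    rw [h₁, h₂, List.zipWith_map]
    simp [d]
  let p : AddGroupSeminorm G :=
    { toFun := fun g => I.dist 0 g
      map_zero' := I.dist_self 0
      add_le' := fun a b => (I.dist_triangle 0 a (a + b)).trans
        (add_le_add le_rfl (by simpa using htrans a 0 b))
      neg' := fun a => by
        have h : ∀ a, I.dist 0 (-a) ≤ I.dist 0 a := fun a => by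
          have := htrans (-a) a 0
          rw [neg_add_cancel, add_zero] at this
          exact this.trans_eq (I.dist_comm a 0)
        exact le_antisymm (h a) (by simpa using h (-a)) }
  have hpφ : ∀ g, p g ≤ φ g := fun g => (hle 0 g).trans_eq (by simp [d])
  have hφp : ∀ g, (φ g : ℝ) ≤ 2 * p g := fun g =>
    (hge 0 g).trans_eq' (by simp [d])
  refine ⟨p, ?_, 1 / 2, by norm_num, fun g hg => hBU ?_⟩
  · refine continuous_iff_continuousAt.2 fun g => ?_
    refine Metric.tendsto_nhds.2 fun ε hε => ?_
    obtain ⟨n, hn⟩ := exists_pow_lt_of_lt_one hε (by norm_num : (1 / 2 : ℝ) < 1)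
    have hmem : {h : G | h - g ∈ (B n).1} ∈ 𝓝 g :=
      (continuous_id.sub continuous_const).continuousAt.preimage_mem_nhds (by simpa using (B n).2)
    filter_upwards [hmem] with h hh
    have hlt : φ (h - g) < (1 / 2) ^ n := not_le.1 fun hc => (hφ _ _).1 hc hh
    have hlt' : (φ (h - g) : ℝ) < (1 / 2) ^ n := by exact_mod_cast hlt
    rw [Real.dist_eq]
    exact (abs_sub_map_le_sub p h g).trans_lt ((hpφ _).trans_lt (hlt'.trans hn))
  · by_contra hg0
    have h1 : (1 : ℝ) ≤ φ g := by exact_mod_cast (by simpa using (hφ g 0).2 hg0)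
    linarith [hφp g]

theorem AddGroupSeminorm.apply_zsmul_le {G : Type*} [AddCommGroup G] (p : AddGroupSeminorm G)
    (n : ℤ) (g : G) : p (n • g) ≤ ‖n‖ * p g := by
  have hnat : ∀ k : ℕ, p (k • g) ≤ k * p g := by
    intro k
    induction k with
    | zero => simp
    | succ k ih =>
      rw [succ_nsmul, Nat.cast_succ, add_one_mul]
      exact (map_add_le_add p _ _).trans (by linarith)
  rcases Int.eq_nat_or_neg n with ⟨k, rfl | rfl⟩
  · simpa using hnat k
  · simpa [map_neg_eq_map] using hnat k

theorem AddGroupSeminorm.continuous_of_le {G : Type*} [AddCommGroup G] [TopologicalSpace G]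
    {p q : AddGroupSeminorm G} {C : ℝ} (h : ∀ g, p g ≤ C * q g) (hq : ∀ a, Filter.Tendsto
      (fun b => q (b - a)) (𝓝 a) (𝓝 0)) : Continuous p := by
  refine continuous_iff_continuousAt.2 fun a => ?_
  rw [ContinuousAt, tendsto_iff_dist_tendsto_zero]
  have hlim := (hq a).const_mul C
  rw [mul_zero] at hlim
  refine squeeze_zero (fun _ => dist_nonneg) (fun b => ?_) hlim
  rw [Real.dist_eq]
  exact (abs_sub_map_le_sub p b a).trans (h _)

/-- `partitionNorm` as a group seminorm. -/
noncomputable def partitionSeminorm {X V R : Type*} [LinearOrder X] [WellFoundedLT X]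
    [AddCommGroup V] [AddCommGroup R] (p : AddGroupSeminorm V) (e : X → V)
    (w : AddGroupSeminorm R) : AddGroupSeminorm (X →₀ R) where
  toFun := partitionNorm p e w
  map_zero' := partitionNorm_zero
  add_le' := partitionNorm_add_le
  neg' := partitionNorm_neg

/-! ### Free locally convex spaces -/

/-- Mathlib's gauge seminorms of absolutely convex sets give the topology of a space that is
locally convex over `𝕜`; here local convexity over `ℝ` is the hypothesis. -/
theorem exists_continuous_seminorm_of_locallyConvexSpace_real {𝕜 E : Type*} [RCLike 𝕜]
    [AddCommGroup E] [Module 𝕜 E] [Module ℝ E] [IsScalarTower ℝ 𝕜 E] [TopologicalSpace E]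
    [IsTopologicalAddGroup E] [ContinuousSMul 𝕜 E] [LocallyConvexSpace ℝ E]
    {U : Set E} (hU : U ∈ 𝓝 0) :
    ∃ p : Seminorm 𝕜 E, Continuous p ∧ ∀ x, p x < 1 → x ∈ U := by
  have : ContinuousSMul ℝ E := IsScalarTower.continuousSMul 𝕜
  obtain ⟨W, ⟨hW, hWc⟩, hWU⟩ := (LocallyConvexSpace.convex_basis_zero ℝ E).mem_iff.1 hU
  let D := convexHull ℝ (balancedCore 𝕜 W)
  have hD : D ∈ 𝓝 (0 : E) :=
    Filter.mem_of_superset (balancedCore_mem_nhds_zero hW) (subset_convexHull ℝ _)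
  have hDW : D ⊆ W := convexHull_min (balancedCore_subset W) hWc
  have hDc : Convex ℝ D := convex_convexHull ℝ _
  have hDb : Balanced 𝕜 D := by
    refine balanced_iff_smul_mem.2 fun a ha x hx => ?_
    have hpre : Convex ℝ {x | a • x ∈ D} := hDc.linear_preimage
      ((LinearMap.lsmul 𝕜 E a).restrictScalars ℝ)
    have hsub : balancedCore 𝕜 W ⊆ {x | a • x ∈ D} := fun y hy => subset_convexHull ℝ _
      (balanced_iff_smul_mem.1 (balancedCore_balanced W) ha hy)
    exact convexHull_min hsub hpre hx
  refine ⟨gaugeSeminorm hDb hDc (absorbent_nhds_zero hD), ?_, fun x hx => hWU (hDW ?_)⟩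
  · exact continuous_gauge hDc hD
  · have : x ∈ interior D := by
      rw [← setOfPred_gauge_lt_one_eq_interior hDc hD]
      exact hx
    exact interior_subset this

/-- The universal property for seminorms: a seminorm on `L(X)` is continuous if it is continuous on
the points of `X`. -/
theorem FreeLCS.tendsto_seminorm_sub {𝕜 : Type v} [RCLike 𝕜] {X : Type u} [TopologicalSpace X]
    (q : Seminorm 𝕜 (FreeLCS 𝕜 X))
    (hq : ∀ x, Filter.Tendsto (fun y => q (basis 𝕜 X y - basis 𝕜 X x)) (𝓝 x) (𝓝 0))
    (a : FreeLCS 𝕜 X) : Filter.Tendsto (fun b => q (b - a)) (𝓝 a) (𝓝 0) := by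
  let F : SeminormFamily 𝕜 (FreeLCS 𝕜 X) Unit := fun _ => q
  let t : TopologicalSpace (FreeLCS 𝕜 X) := F.moduleFilterBasis.topology
  have hF : @WithSeminorms 𝕜 (FreeLCS 𝕜 X) Unit _ _ _ F t := ⟨rfl⟩
  have hle : instTopologicalSpace 𝕜 X ≤ t := by
    refine sInf_le ⟨hF.topologicalAddGroup, hF.continuousSMul, hF.toLocallyConvexSpace, ?_⟩
    refine continuous_iff_continuousAt.2 fun x => (hF.tendsto_nhds _ _).2 fun _ ε hε => ?_
    exact (hq x).eventually (gt_mem_nhds hε)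
  have ht : Filter.Tendsto (fun b => q (b - a)) (@nhds _ t a) (𝓝 0) := by
    refine Metric.tendsto_nhds.2 fun ε hε => ?_
    filter_upwards [(hF.tendsto_nhds id a).1 Filter.tendsto_id () ε hε] with b hb
    rw [Real.dist_eq, sub_zero, abs_of_nonneg (apply_nonneg q _)]
    exact hb
  exact ht.mono_left (nhds_mono hle)

/-- The size `w` of the scalars has to be of negative type, while continuity on `L(X)` comes from a
seminorm over `𝕜`, hence from the norm of the scalars; this is why the two are allowed to differ. -/
theorem FreeLCS.unitarilyRepresentable {𝕜 : Type} [RCLike 𝕜] (X : Type u) [TopologicalSpace X]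
    [T35Space X] {w : AddGroupSeminorm 𝕜} (hw : IsNegativeType w) (hle : ∀ r, ‖r‖ ≤ w r) {C : ℝ}
    (hC : ∀ r, w r ≤ C * ‖r‖) : UnitarilyRepresentable (Multiplicative (FreeLCS 𝕜 X)) := by
  refine unitarilyRepresentable_of_isNegativeType fun U hU => ?_
  obtain ⟨_, _⟩ := exists_wellFoundedLT X
  obtain ⟨p, hpc, hpU⟩ := exists_continuous_seminorm_of_locallyConvexSpace_real (𝕜 := 𝕜) hU
  let φ : FreeLCS 𝕜 X →ₗ[𝕜] X →₀ 𝕜 := (basis 𝕜 X).repr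
  -- `N` is of negative type and dominates `p`; it is continuous because `C * q` dominates it
  let n : AddGroupSeminorm 𝕜 := (normSeminorm 𝕜 𝕜).toAddGroupSeminorm
  let q : Seminorm 𝕜 (FreeLCS 𝕜 X) := Seminorm.of
    (fun v => partitionNorm p.toAddGroupSeminorm (basis 𝕜 X) n (φ v))
    (fun v v' => by rw [map_add]; exact partitionNorm_add_le _ _)
    (fun r v => by rw [map_smul]; exact partitionNorm_smul (fun a => norm_smul r a) _)
  have hq : ∀ x, Filter.Tendsto (fun y => q (basis 𝕜 X y - basis 𝕜 X x)) (𝓝 x) (𝓝 0) := by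
    intro x
    have hcont : Continuous fun y => p (basis 𝕜 X y - basis 𝕜 X x) :=
      hpc.comp ((continuous_basis 𝕜 X).sub continuous_const)
    have h := hcont.tendsto x
    rw [sub_self, map_zero] at h
    refine ((tendsto_partitionNorm_single_sub_single (p := p.toAddGroupSeminorm)
      (e := basis 𝕜 X) (w := n) (1 : 𝕜) x).comp (Filter.tendsto_comap_iff.2 h)).congr fun y => ?_
    change _ = partitionNorm _ _ _ ((basis 𝕜 X).repr _)
    rw [map_sub, Module.Basis.repr_self, Module.Basis.repr_self]
    rfl
  let N : AddGroupSeminorm (FreeLCS 𝕜 X) :=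
    (partitionSeminorm p.toAddGroupSeminorm (basis 𝕜 X) w).comp φ.toAddMonoidHom
  refine ⟨N, AddGroupSeminorm.continuous_of_le (q := q.toAddGroupSeminorm)
    (fun v => partitionNorm_le_mul hC (φ v)) (tendsto_seminorm_sub q hq),
    (isNegativeType_partitionNorm hw).comp φ.toAddMonoidHom, 1, one_pos, fun v hv => hpU v ?_⟩
  have h := apply_linearCombination_le_partitionNorm (p := p.toAddGroupSeminorm)
    (e := basis 𝕜 X) (w := w) (fun r a => (map_smul_eq_mul p r a).trans_le
      (mul_le_mul_of_nonneg_right (hle r) (apply_nonneg p a))) (φ v)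
  have hv' : Finsupp.linearCombination 𝕜 (basis 𝕜 X) (φ v) = v :=
    (basis 𝕜 X).linearCombination_repr v
  rw [hv'] at h
  exact lt_of_le_of_lt h hv

/-! ### Free abelian topological groups -/

/-- The universal property for seminorms: a group seminorm on `A(X)` is continuous if it is
continuous on the points of `X`. -/
theorem FreeAbTopGroup.tendsto_addGroupSeminorm_sub {X : Type u} [TopologicalSpace X]
    (q : AddGroupSeminorm (FreeAbTopGroup X))
    (hq : ∀ x, Filter.Tendsto (fun y => q (of X y - of X x)) (𝓝 x) (𝓝 0))
    (a : FreeAbTopGroup X) : Filter.Tendsto (fun b => q (b - a)) (𝓝 a) (𝓝 0) := by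
  let I : SeminormedAddCommGroup (FreeAbTopGroup X) := q.toSeminormedAddCommGroup
  let u : UniformSpace (FreeAbTopGroup X) := I.toPseudoMetricSpace.toUniformSpace
  let t : TopologicalSpace (FreeAbTopGroup X) := u.toTopologicalSpace
  have hle : instTopologicalSpace X ≤ t := by
    refine sInf_le ⟨@IsUniformAddGroup.to_topologicalAddGroup _ u _ inferInstance, ?_⟩
    refine continuous_iff_continuousAt.2 fun x => ?_
    exact (@tendsto_iff_norm_sub_tendsto_zero _ _ I _ _ _).2 (hq x)
  have ht : Filter.Tendsto (fun b => q (b - a)) (@nhds _ t a) (𝓝 0) :=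
    (@tendsto_iff_norm_sub_tendsto_zero _ _ I id _ _).1 Filter.tendsto_id
  exact ht.mono_left (nhds_mono hle)

theorem FreeAbTopGroup.unitarilyRepresentable (X : Type u) [TopologicalSpace X] [T35Space X] :
    UnitarilyRepresentable (Multiplicative (FreeAbTopGroup X)) := by
  refine unitarilyRepresentable_of_isNegativeType fun U hU => ?_
  obtain ⟨_, _⟩ := exists_wellFoundedLT X
  obtain ⟨p, hpc, ε, hε, hpU⟩ := exists_continuous_addGroupSeminorm hU
  let φ : FreeAbTopGroup X →+ X →₀ ℤ := FreeAbelianGroup.toFinsupp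
  have hφof : ∀ x, φ (of X x) = Finsupp.single x 1 := FreeAbelianGroup.toFinsupp_of
  let n : AddGroupSeminorm ℤ := normAddGroupSeminorm ℤ
  have hn : IsNegativeType n := by
    convert IsNegativeType.abs.comp (Int.castAddHom ℝ) using 1
    ext k
    exact Int.norm_eq_abs k
  let N : AddGroupSeminorm (FreeAbTopGroup X) := (partitionSeminorm p (of X) n).comp φ
  have hN : ∀ x, Filter.Tendsto (fun y => N (of X y - of X x)) (𝓝 x) (𝓝 0) := by
    intro x
    have hcont : Continuous fun y => p (of X y - of X x) :=
      hpc.comp ((continuous_of X).sub continuous_const)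
    have h := hcont.tendsto x
    rw [sub_self, map_zero] at h
    refine ((tendsto_partitionNorm_single_sub_single (p := p)
      (e := of X) (w := n) (1 : ℤ) x).comp (Filter.tendsto_comap_iff.2 h)).congr fun y => ?_
    change _ = partitionNorm _ _ _ (φ _)
    rw [map_sub, hφof, hφof]
    rfl
  refine ⟨N, AddGroupSeminorm.continuous_of_le (q := N) (C := 1) (fun v => (one_mul _).ge)
    (tendsto_addGroupSeminorm_sub N hN), (isNegativeType_partitionNorm hn).comp φ, ε, hε,
    fun v hv => hpU v ?_⟩
  have h := apply_linearCombination_le_partitionNorm (p := p) (e := of X) (w := n)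
    (fun k g => p.apply_zsmul_le k g) (φ v)
  have hv' : Finsupp.linearCombination ℤ (of X) (φ v) = v := by
    have : (Finsupp.linearCombination ℤ (of X)).toAddMonoidHom.comp φ =
        AddMonoidHom.id (FreeAbTopGroup X) :=
      FreeAbelianGroup.lift_ext _ _ fun x => by
        change Finsupp.linearCombination ℤ (of X) (φ (of X x)) = of X x
        simp [hφof]
    exact DFunLike.congr_fun this v
  rw [hv'] at h
  exact lt_of_le_of_lt h hv

theorem theorem1 (X : Type u) [TopologicalSpace X] [T35Space X] :
    UnitarilyRepresentable (Multiplicative (FreeLCS ℝ X)) ∧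
      UnitarilyRepresentable (Multiplicative (FreeLCS ℂ X)) ∧
      UnitarilyRepresentable (Multiplicative (FreeAbTopGroup X)) := by
  refine ⟨?_, ?_, FreeAbTopGroup.unitarilyRepresentable X⟩
  · exact FreeLCS.unitarilyRepresentable X (w := normAddGroupSeminorm ℝ) (C := 1)
      IsNegativeType.abs (fun _ => le_rfl) fun _ => (one_mul _).ge
  -- `|re| + |im|` instead of the modulus reduces negative type to the real case
  · let w : AddGroupSeminorm ℂ := (normAddGroupSeminorm ℝ).comp Complex.reAddGroupHom +
      (normAddGroupSeminorm ℝ).comp Complex.imAddGroupHom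
    refine FreeLCS.unitarilyRepresentable X (w := w) (C := 2)
      ((IsNegativeType.abs.comp Complex.reAddGroupHom).add
        (IsNegativeType.abs.comp Complex.imAddGroupHom)) Complex.norm_le_abs_re_add_abs_im
      fun z => ?_
    change |z.re| + |z.im| ≤ 2 * ‖z‖
    linarith [Complex.abs_re_le_norm z, Complex.abs_im_le_norm z]
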